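/- **Conventions.** $y^x=x^{-1}yx$ and $[x,y]=x^{-1}y^{-1}xy$. A *polycyclic presentation* on ordered generators $x_1,\dots,x_m$, with index set $I\subseteq\{1,\dots,m\}$ and exponents $e_i\ge 1$ ($i\in I$), consists of relations $$x_i^{e_i}=x_{i+1}^{\alpha_{i,i+1}}\cdots x_m^{\alpha_{i,m}}\ (i\in I),\qquad x_j^{-1}x_ix_j=x_{j+1}^{\beta_{i,j,j+1}}\cdots x_m^{\beta_{i,j,m}}\ (j<i),\qquad x_jx_ix_j^{-1}=x_{j+1}^{\gamma_{i,j,j+1}}\cdots x_m^{\gamma_{i,j,m}}\ (j<i,\ j\notin I)$$ with integer exponents. It is *consistent* if every element of the group it defines can be written in exactly one way as $x_1^{a_1}\cdots x_m^{a_m}$ with $a_i\in\mathbb Z$ and $0\le a_i<e_i$ for $i\in I$. Let $G$ be a group and $q\ge 0$ an integer. For $q\ge1$ let $\widehat{\mathcal G}=\{\widehat k\mid k\in G\}$ be a set of symbols; for $q=0$ let $\widehat{\mathcal G}=\emptyset$. * $G\otimes^qG$ is the group generated by the symbols $g\otimes h$ ($g,h\in G$) and $\widehat k\in\widehat{\mathcal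 G}$, with relations $g\otimes hh_1=(g\otimes h_1)(g^{h_1}\otimes h^{h_1})$ and $gg_1\otimes h=(g^{g_1}\otimes h^{g_1})(g_1\otimes h)$ and, if $q\geq 1$, $(g\otimes h)^{\widehat k}=g^{k^q}\otimes h^{k^q}$, $\ \widehat{kk_1}=\widehat k\,\prod_{i=1}^{q-1}\bigl(k\otimes (k_1^{-i})^{k^{q-1-i}}\bigr)\,\widehat{k_1}$, $\ [\widehat k,\widehat{k_1}]=k^q\otimes k_1^q$, $\ \widehat{[g,h]}=(g\otimes h)^q$. The subgroup $\nabla^q(G)=\langle g\otimes g\mid g\in G\rangle$ is normal, $G\wedge^qG=(G\otimes^qG)/\nabla^q(G)$, and $g\wedge h$, $\widehat k$ denote the images of $g\otimes h$, $\widehat k$. $G$ acts on $G\wedge^qG$ by $(g\wedge h)^x=g^x\wedge h^x$, $\widehat k^{\,x}=\widehat{k^x}$. Let $\lambda:G\times G\times G\to G\wedge^qG$ be the $q$-biderivation $(g,h,k)\lambda=(g\wedge h)\,\widehat k$ (with $\widehat k=1$ if $q=0$). * $\nu^q(G)$ is generated by $G$, an isomorphic copy $G^\varphi$ of $G$, and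 $\widehat{\mathcal G}$, with relations $[g,h^\varphi]^k=[g^k,(h^k)^\varphi]=[g,h^\varphi]^{k^\varphi}$ and, if $q\ge1$, $\widehat k^{\,g}=\widehat{k^g}=\widehat k^{\,g^\varphi}$, $\ [g,h^\varphi]^{\widehat k}=[g^{k^q},(h^{k^q})^\varphi]$, $\ \widehat k^{-1}\,\widehat{kk_1}\,\widehat{k_1}^{-1}=\prod_{i=1}^{q-1}[k,(k_1^{-i})^\varphi]^{k^{q-1-i}}$, $\ [\widehat k,\widehat{k_1}]=[k^q,(k_1^q)^\varphi]$, $\ \widehat{[g,h]}=[g,h^\varphi]^q$. Let $\Delta^q(G)=\langle [g,g^\varphi]\mid g\in G\rangle\le\nu^q(G)$. Let $G$ be given by a consistent polycyclic presentation with generators $g_1,\dots,g_n$, relators $r_1,\dots,r_l$ and index set $I$, and let $G\wedge^qG$ be given by a consistent polycyclic presentation with generators $w_1,\dots,w_r$ and relators $u_1,\dots,u_s$. For each $a\in G\wedge^qG$ fix a word $w_1^{c_1}\cdots w_r^{c_r}$ ($c_i\in\mathbb Z$) representing $a$. Let $\tau^q(G)$ be the group generated by $g_1,\dots,g_n,g_1^\varphi,\dots,g_n^\varphi,w_1,\dots,w_r$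 (in this order), with relations 1. $r_i(g_1,\dots,g_n)=1$ for $1\le i\le l$; 2. $r_i(g_1^\varphi,\dots,g_n^\varphi)=1$ for $1\le i\le l$; 3. $u_i(w_1,\dots,w_r)=1$ for $1\le i\le s$; 4. $g_i^{-1}g_j^\varphi g_i=g_j^\varphi\bigl((g_i,g_j,1)\lambda\bigr)^{-1}$ for all $i,j$, and $g_ig_j^\varphi g_i^{-1}=g_j^\varphi\bigl((g_i^{-1},g_j,1)\lambda\bigr)^{-1}$ for all $i\notin I$ and all $j$; 5. $g_j^{-1}w_ig_j=w_i^{g_j}=(g_j^{\varphi})^{-1}w_ig_j^\varphi$ for all $i,j$, and $g_jw_ig_j^{-1}=w_i^{g_j^{-1}}=g_j^\varphi w_i(g_j^{\varphi})^{-1}$ for all $i$ and all $j\notin I$, where the elements $\bigl((g_i^{\pm1},g_j,1)\lambda\bigr)^{-1}$ and $w_i^{g_j^{\pm1}}$ of $G\wedge^qG$ are replaced by the chosen words, and in (5) each chain of equalities stands for two relations, one for $g_j$ and one for $g_j^\varphi$. **Theorem.** Let $W=\langle w_1,\dots,w_r\rangle\le\tau^q(G)$. Then: (i) $W$ is normal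 in $\tau^q(G)$, and $\tau^q(G)/W\cong G\times G$ by an isomorphism with $g_iW\mapsto(g_i,1)$ and $g_i^\varphi W\mapsto(1,g_i)$ for $1\le i\le n$. (ii) The above presentation of $\tau^q(G)$ is a consistent polycyclic presentation. (iii) $G\wedge^qG\cong W$ by an isomorphism $\theta$ with $\theta(w_i)=w_i$ for $1\le i\le r$. (iv) There is a homomorphism $\psi:\nu^q(G)\to\tau^q(G)$ with $(g_i)\psi=g_i$ and $(g_i^\varphi)\psi=g_i^\varphi$ for $1\le i\le n$, and $(\widehat k)\psi=\theta\bigl((1,1,k)\lambda\bigr)$ for all $\widehat k\in\widehat{\mathcal G}$; and $\operatorname{Ker}\psi=\Delta^q(G)$. -/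

import Mathlib

namespace QTau

section Basic

variable {G : Type*} [Group G]

/-- The conjugate `y ^ x = x⁻¹ y x` (right action). -/
def rconj (y x : G) : G := x⁻¹ * y * x

/-- The commutator `[x, y] = x⁻¹ y⁻¹ x y`. -/
def rcomm (x y : G) : G := x⁻¹ * y⁻¹ * x * y

theorem rconj_mul (a b x : G) : rconj (a * b) x = rconj a x * rconj b x := by
  simp only [rconj]; group

theorem rconj_inv (a x : G) : rconj a⁻¹ x = (rconj a x)⁻¹ := by
  simp only [rconj]; group

theorem rconj_pow (a x : G) (n : ℕ) : rconj (a ^ n) x = rconj a x ^ n := by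
  induction n with
  | zero => simp [rconj]
  | succ n ih => rw [pow_succ, pow_succ, rconj_mul, ih]

theorem rconj_rconj (a b x : G) : rconj (rconj a b) x = rconj (rconj a x) (rconj b x) := by
  simp only [rconj]; group

theorem rconj_rcomm (a b x : G) : rconj (rcomm a b) x = rcomm (rconj a x) (rconj b x) := by
  simp only [rconj, rcomm]; group

variable {L : Type*} [Group L]

theorem map_rconj (f : G →* L) (a b : G) : f (rconj a b) = rconj (f a) (f b) := by
  simp [rconj]

theorem map_rcomm (f : G →* L) (a b : G) : f (rcomm a b) = rcomm (f a) (f b) := by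
  simp [rcomm]

end Basic

/-! ### Polycyclic presentations -/

section Pc

variable {X : Type*} [Fintype X] [LinearOrder X] {H : Type*} [Group H]

/-- The ordered product of the powers `x k ^ a k`, with `k` increasing. -/
def collect (x : X → H) (a : X → ℤ) : H :=
  ((Finset.univ.sort (· ≤ ·)).map fun k => x k ^ a k).prod

/-- The ordered product of the powers `x k ^ a k` over the indices `k > i`, with `k` increasing. -/
def collectAbove (i : X) (x : X → H) (a : X → ℤ) : H :=
  (((Finset.univ.filter (i < ·)).sort (· ≤ ·)).map fun k => x k ^ a k).prod

/-- The data of a polycyclic presentation on the finite ordered set of generators `X`: the set `I`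
of generators with a power relation, the exponents `e i ≥ 1` (`i ∈ I`), and the exponents of the
right-hand sides. Values outside the ranges used in `PcPresentation.Rel` play no role. -/
structure PcPresentation (X : Type*) [Fintype X] [LinearOrder X] where
  I : Set X
  e : X → ℕ
  e_pos : ∀ i ∈ I, 0 < e i
  α : X → X → ℤ
  β : X → X → X → ℤ
  γ : X → X → X → ℤ

namespace PcPresentation

variable (P : PcPresentation X)

/-- The relators of a polycyclic presentation. -/
inductive Rel : FreeGroup X → Prop
  | power (i : X) (hi : i ∈ P.I) :
      Rel (FreeGroup.of i ^ P.e i * (collectAbove i FreeGroup.of (P.α i))⁻¹)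
  | conj (i j : X) (hji : j < i) :
      Rel ((FreeGroup.of j)⁻¹ * FreeGroup.of i * FreeGroup.of j *
        (collectAbove j FreeGroup.of (P.β i j))⁻¹)
  | conjInv (i j : X) (hji : j < i) (hj : j ∉ P.I) :
      Rel (FreeGroup.of j * FreeGroup.of i * (FreeGroup.of j)⁻¹ *
        (collectAbove j FreeGroup.of (P.γ i j))⁻¹)

/-- The set of relators. -/
def rels : Set (FreeGroup X) := {x | P.Rel x}

/-- The group defined by the presentation. -/
abbrev Grp : Type _ := PresentedGroup P.rels

/-- The generators of the group defined by the presentation. -/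
def gen (i : X) : P.Grp := PresentedGroup.of i

/-- The exponent vector `a` is reduced: `0 ≤ a i < e i` for all `i ∈ I`. -/
def IsReduced (a : X → ℤ) : Prop := ∀ i ∈ P.I, 0 ≤ a i ∧ a i < P.e i

/-- A polycyclic presentation is consistent if each element of its group is, in exactly one way,
an ordered product of powers of the generators with a reduced exponent vector. -/
def Consistent : Prop :=
  ∀ h : P.Grp, ∃! a : X → ℤ, P.IsReduced a ∧ collect P.gen a = h

/-- The group `H` is given by the presentation `P`, on the elements `x i` of `H`. -/
def Presents (x : X → H) : Prop := ∃ f : P.Grp ≃* H, ∀ i, f (P.gen i) = x i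

end PcPresentation

/-- A set of relators on the ordered generators `X` is a consistent polycyclic presentation. -/
def IsConsistentPcPresentation (R : Set (FreeGroup X)) : Prop :=
  ∃ T : PcPresentation X, T.rels = R ∧ T.Consistent

end Pc

/-! ### The `q`-tensor square and the `q`-exterior square -/

/-- The symbols `k̂`, one for each `k : G` if `q ≥ 1`, and none if `q = 0`. -/
abbrev HatSymbol (G : Type*) (q : ℕ) : Type _ := {_k : G // q ≠ 0}

/-- The generating symbols `g ⊗ h` and `k̂` of the `q`-tensor square. -/
abbrev TensorGen (G : Type*) (q : ℕ) : Type _ := (G × G) ⊕ HatSymbol G q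

section Tensor

variable (G : Type*) [Group G] (q : ℕ)

variable {G q} in
/-- The symbol `g ⊗ h` in the free group. -/
def symT (g h : G) : FreeGroup (TensorGen G q) := FreeGroup.of (Sum.inl (g, h))

variable {G q} in
/-- The symbol `k̂` in the free group. -/
def symHat (hq : q ≠ 0) (k : G) : FreeGroup (TensorGen G q) := FreeGroup.of (Sum.inr ⟨k, hq⟩)

/-- The relators of the `q`-tensor square. In `hat_mul` the factors are ordered by
`i = 1, …, q - 1`, where `i` is `j + 1`. -/
inductive TensorRel : FreeGroup (TensorGen G q) → Prop
  | right_mul (g h h₁ : G) :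
      TensorRel (symT g (h * h₁) * (symT g h₁ * symT (rconj g h₁) (rconj h h₁))⁻¹)
  | left_mul (g g₁ h : G) :
      TensorRel (symT (g * g₁) h * (symT (rconj g g₁) (rconj h g₁) * symT g₁ h)⁻¹)
  | conj_hat (hq : q ≠ 0) (g h k : G) :
      TensorRel (rconj (symT g h) (symHat hq k) *
        (symT (rconj g (k ^ q)) (rconj h (k ^ q)))⁻¹)
  | hat_mul (hq : q ≠ 0) (k k₁ : G) :
      TensorRel (symHat hq (k * k₁) * (symHat hq k *
        ((List.range (q - 1)).map fun j =>
          symT (rconj k (k ^ (q - 1 - (j + 1))))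
            (rconj (k₁ ^ (j + 1))⁻¹ (k ^ (q - 1 - (j + 1))))).prod *
        symHat hq k₁)⁻¹)
  | comm_hat (hq : q ≠ 0) (k k₁ : G) :
      TensorRel (rcomm (symHat hq k) (symHat hq k₁) * (symT (k ^ q) (k₁ ^ q))⁻¹)
  | hat_comm (hq : q ≠ 0) (g h : G) :
      TensorRel (symHat hq (rcomm g h) * (symT g h ^ q)⁻¹)

/-- The `q`-tensor square `G ⊗^q G`. -/
abbrev TensorSquare : Type _ := PresentedGroup {x | TensorRel G q x}

variable {G}

/-- The element `g ⊗ h` of `G ⊗^q G`. -/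
def tens (g h : G) : TensorSquare G q := PresentedGroup.of (Sum.inl (g, h))

/-- The element `k̂` of `G ⊗^q G` (for `q = 0`, where there are no such symbols, it is `1`). -/
def thatE (k : G) : TensorSquare G q :=
  if hq : q ≠ 0 then PresentedGroup.of (Sum.inr ⟨k, hq⟩) else 1

variable (G) in
/-- The subgroup `∇^q(G)` generated by all `g ⊗ g`. -/
def nabla : Subgroup (TensorSquare G q) := Subgroup.closure {t | ∃ g : G, t = tens q g g}

theorem mk_eq_of_rel {a b : FreeGroup (TensorGen G q)} (h : TensorRel G q (a * b⁻¹)) :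
    PresentedGroup.mk {x | TensorRel G q x} a = PresentedGroup.mk {x | TensorRel G q x} b := by
  have := PresentedGroup.one_of_mem (rels := {x | TensorRel G q x}) h
  rw [map_mul, map_inv] at this
  exact mul_inv_eq_one.mp this

theorem tens_mul_right (g h h₁ : G) :
    tens q g (h * h₁) = tens q g h₁ * tens q (rconj g h₁) (rconj h h₁) := by
  simpa only [map_mul] using! mk_eq_of_rel q (TensorRel.right_mul g h h₁)

theorem tens_mul_left (g g₁ h : G) :
    tens q (g * g₁) h = tens q (rconj g g₁) (rconj h g₁) * tens q g₁ h := by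
  simpa only [map_mul] using! mk_eq_of_rel q (TensorRel.left_mul g g₁ h)

theorem tens_conj_hat (hq : q ≠ 0) (g h k : G) :
    rconj (tens q g h) (PresentedGroup.of (Sum.inr ⟨k, hq⟩)) =
      tens q (rconj g (k ^ q)) (rconj h (k ^ q)) := by
  simpa only [rconj, map_mul, map_inv] using! mk_eq_of_rel q (TensorRel.conj_hat hq g h k)

theorem tens_conj_tens (a c b d : G) :
    rconj (tens q a c) (tens q b d) = tens q (rconj a (rcomm b d)) (rconj c (rcomm b d)) := by
  have key (a c : G) :
      tens q (rconj a (d * b)) (rconj c (d * b)) * tens q b d =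
        tens q b d * tens q (rconj a (b * d)) (rconj c (b * d)) := by
    have h1 := tens_mul_left q a b (c * d)
    rw [rconj_mul, tens_mul_right q (rconj a b), tens_mul_right q b c d] at h1
    have h2 := tens_mul_right q (a * b) c d
    rw [tens_mul_left q a b d, rconj_mul, tens_mul_left q (rconj a d)] at h2
    rw [h2] at h1
    simp only [mul_assoc] at h1
    have h3 := mul_left_cancel h1
    simp only [← mul_assoc] at h3
    have h4 := mul_right_cancel h3
    have e1 (x : G) : rconj (rconj x d) (rconj b d) = rconj x (b * d) := by
      simp only [rconj]; group
    have e2 (x : G) : rconj (rconj x b) (rconj d b) = rconj x (d * b) := by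
      simp only [rconj]; group
    simp only [e1, e2] at h4
    exact h4.symm
  have h := key (rconj a (d * b)⁻¹) (rconj c (d * b)⁻¹)
  have e1 (x : G) : rconj (rconj x (d * b)⁻¹) (d * b) = x := by
    simp only [rconj]; group
  have e2 (x : G) : rconj (rconj x (d * b)⁻¹) (b * d) = rconj x (rcomm b d) := by
    simp only [rconj, rcomm]; group
  simp only [e1, e2] at h
  rw [rconj, mul_assoc, h, inv_mul_cancel_left]

theorem exists_tens_conj (t : TensorSquare G q) :
    ∃ z : G, ∀ a c : G, rconj (tens q a c) t = tens q (rconj a z) (rconj c z) := by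
  have ht : t ∈ Subgroup.closure (Set.range (PresentedGroup.of (rels := {x | TensorRel G q x}))) := by
    rw [PresentedGroup.closure_range_of]; trivial
  induction ht using Subgroup.closure_induction with
  | mem x hx =>
    obtain ⟨y | y, rfl⟩ := hx
    · exact ⟨rcomm y.1 y.2, fun a c => tens_conj_tens q a c y.1 y.2⟩
    · exact ⟨y.1 ^ q, fun a c => tens_conj_hat q y.2 a c y.1⟩
  | one => exact ⟨1, fun a c => by simp [rconj]⟩
  | mul x y _ _ hx hy =>
    obtain ⟨z, hz⟩ := hx
    obtain ⟨z', hz'⟩ := hy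
    have e {K : Type _} [Group K] (a x y : K) : rconj a (x * y) = rconj (rconj a x) y := by
      simp only [rconj]; group
    exact ⟨z * z', fun a c => by rw [e, hz, hz', e, e]⟩
  | inv x _ hx =>
    obtain ⟨z, hz⟩ := hx
    refine ⟨z⁻¹, fun a c => ?_⟩
    have h := hz (rconj a z⁻¹) (rconj c z⁻¹)
    have e (x : G) : rconj (rconj x z⁻¹) z = x := by simp only [rconj]; group
    rw [e, e] at h
    rw [← h]
    simp only [rconj]; group

instance nabla_normal : (nabla G q).Normal := by
  rw [nabla]
  apply Subgroup.Normal.mk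
  intro n hn t
  obtain ⟨z, hz⟩ := exists_tens_conj q t⁻¹
  induction hn using Subgroup.closure_induction with
  | mem x hx =>
    obtain ⟨g, rfl⟩ := hx
    refine Subgroup.subset_closure ⟨rconj g z, ?_⟩
    rw [← hz, rconj, inv_inv]
  | one => simp
  | mul x y _ _ hx hy =>
    have : t * (x * y) * t⁻¹ = (t * x * t⁻¹) * (t * y * t⁻¹) := by group
    rw [this]; exact mul_mem hx hy
  | inv x _ hx =>
    have : t * x⁻¹ * t⁻¹ = (t * x * t⁻¹)⁻¹ := by group
    rw [this]; exact inv_mem hx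

theorem tensorRel_act (x : G) : ∀ r ∈ {x | TensorRel G q x},
    FreeGroup.lift (Sum.elim (fun p : G × G => tens q (rconj p.1 x) (rconj p.2 x))
      (fun k : HatSymbol G q =>
        PresentedGroup.of (rels := {x | TensorRel G q x}) (Sum.inr ⟨rconj k.1 x, k.2⟩))) r = 1 := by
  intro r hr
  have key : ∀ s : FreeGroup (TensorGen G q),
      FreeGroup.lift (Sum.elim (fun p : G × G => tens q (rconj p.1 x) (rconj p.2 x))
      (fun k : HatSymbol G q =>
        PresentedGroup.of (rels := {x | TensorRel G q x}) (Sum.inr ⟨rconj k.1 x, k.2⟩))) s =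
      PresentedGroup.mk _ (FreeGroup.map (Sum.map (fun p : G × G => (rconj p.1 x, rconj p.2 x))
        (fun k : HatSymbol G q => (⟨rconj k.1 x, k.2⟩ : HatSymbol G q))) s) := by
    intro s
    rw [← MonoidHom.comp_apply]
    congr 1
    ext (p | k) <;> simp [tens, PresentedGroup.of]
  rw [key]
  apply PresentedGroup.one_of_mem
  have hT (g h : G) : FreeGroup.map (Sum.map (fun p : G × G => (rconj p.1 x, rconj p.2 x))
        (fun k : HatSymbol G q => (⟨rconj k.1 x, k.2⟩ : HatSymbol G q))) (symT g h) =
      symT (rconj g x) (rconj h x) := by simp [symT]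
  have hH (hq : q ≠ 0) (k : G) :
      FreeGroup.map (Sum.map (fun p : G × G => (rconj p.1 x, rconj p.2 x))
        (fun k : HatSymbol G q => (⟨rconj k.1 x, k.2⟩ : HatSymbol G q))) (symHat hq k) =
      symHat hq (rconj k x) := by simp [symHat]
  cases hr with
  | right_mul g h h₁ =>
    simpa only [Set.mem_ofPred_eq, map_mul, map_inv, hT, ← rconj_mul, ← rconj_rconj] using!
      TensorRel.right_mul (rconj g x) (rconj h x) (rconj h₁ x)
  | left_mul g g₁ h =>
    simpa only [Set.mem_ofPred_eq, map_mul, map_inv, hT, ← rconj_mul, ← rconj_rconj] using!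
      TensorRel.left_mul (rconj g x) (rconj g₁ x) (rconj h x)
  | conj_hat hq g h k =>
    simpa only [Set.mem_ofPred_eq, map_mul, map_inv, hT, hH, map_rconj, ← rconj_mul, ← rconj_rconj, ← rconj_pow] using!
      TensorRel.conj_hat hq (rconj g x) (rconj h x) (rconj k x)
  | hat_mul hq k k₁ =>
    simpa only [Set.mem_ofPred_eq, map_mul, map_inv, hT, hH, map_list_prod, List.map_map, Function.comp_def,
      ← rconj_mul, ← rconj_inv, ← rconj_rconj, ← rconj_pow] using!
      TensorRel.hat_mul hq (rconj k x) (rconj k₁ x)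
  | comm_hat hq k k₁ =>
    simpa only [Set.mem_ofPred_eq, map_mul, map_inv, hT, hH, map_rcomm, ← rconj_pow] using!
      TensorRel.comm_hat hq (rconj k x) (rconj k₁ x)
  | hat_comm hq g h =>
    simpa only [Set.mem_ofPred_eq, map_mul, map_inv, map_pow, hT, hH, ← rconj_rcomm] using!
      TensorRel.hat_comm hq (rconj g x) (rconj h x)

/-- The action of `x : G` on `G ⊗^q G`: `g ⊗ h ↦ g ^ x ⊗ h ^ x` and `k̂ ↦ (k ^ x)̂`. -/
def actTensor (x : G) : TensorSquare G q →* TensorSquare G q :=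
  PresentedGroup.toGroup (tensorRel_act q x)

theorem nabla_le_comap (x : G) : nabla G q ≤ (nabla G q).comap (actTensor q x) := by
  refine (Subgroup.closure_le _).2 ?_
  rintro _ ⟨g, rfl⟩
  refine Subgroup.subset_closure ⟨rconj g x, ?_⟩
  simp [actTensor, tens]

variable (G) in
/-- The `q`-exterior square `G ∧^q G = (G ⊗^q G) / ∇^q(G)`. -/
abbrev ExteriorSquare : Type _ := TensorSquare G q ⧸ nabla G q

/-- The element `g ∧ h`. -/
def wedge (g h : G) : ExteriorSquare G q := QuotientGroup.mk (tens q g h)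

/-- The element `k̂` of `G ∧^q G` (`1` if `q = 0`). -/
def hatE (k : G) : ExteriorSquare G q := QuotientGroup.mk (thatE q k)

/-- The action `w ↦ w ^ x` of `x : G` on `G ∧^q G`: `(g ∧ h) ^ x = g ^ x ∧ h ^ x` and
`k̂ ^ x = (k ^ x)̂`. -/
def act (x : G) : ExteriorSquare G q →* ExteriorSquare G q :=
  QuotientGroup.map (nabla G q) (nabla G q) (actTensor q x) (nabla_le_comap q x)

/-- The `q`-biderivation `λ : G × G × G → G ∧^q G`, `(g, h, k) ↦ (g ∧ h) k̂`. -/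
def lam (g h k : G) : ExteriorSquare G q := wedge q g h * hatE q k

end Tensor

/-! ### The group `ν^q(G)` and its subgroup `Δ^q(G)` -/

section Nu

variable (G : Type*) [Group G] (q : ℕ)

/-- The free product of `G`, its copy `G^φ`, and the free group on the symbols `k̂`. -/
abbrev NuFree : Type _ := Monoid.Coprod (Monoid.Coprod G G) (FreeGroup (HatSymbol G q))

variable {G q} in
/-- The element `g` of the free product. -/
def freeL (g : G) : NuFree G q := Monoid.Coprod.inl (Monoid.Coprod.inl g)

variable {G q} in
/-- The element `g^φ` of the free product. -/
def freeR (g : G) : NuFree G q := Monoid.Coprod.inl (Monoid.Coprod.inr g)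

variable {G q} in
/-- The element `k̂` of the free product. -/
def freeHat (hq : q ≠ 0) (k : G) : NuFree G q := Monoid.Coprod.inr (FreeGroup.of ⟨k, hq⟩)

/-- The relators of `ν^q(G)`: the first two families are those of `ν(G)`. In `hat_mul` the factors
are ordered by `i = 1, …, q - 1`, where `i` is `j + 1`. -/
inductive NuRel : NuFree G q → Prop
  | left (g h k : G) :
      NuRel (rconj (rcomm (freeL g) (freeR h)) (freeL k) *
        (rcomm (freeL (rconj g k)) (freeR (rconj h k)))⁻¹)
  | right (g h k : G) :
      NuRel (rconj (rcomm (freeL g) (freeR h)) (freeR k) *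
        (rcomm (freeL (rconj g k)) (freeR (rconj h k)))⁻¹)
  | hat_left (hq : q ≠ 0) (g k : G) :
      NuRel (rconj (freeHat hq k) (freeL g) * (freeHat hq (rconj k g))⁻¹)
  | hat_right (hq : q ≠ 0) (g k : G) :
      NuRel (rconj (freeHat hq k) (freeR g) * (freeHat hq (rconj k g))⁻¹)
  | conj_hat (hq : q ≠ 0) (g h k : G) :
      NuRel (rconj (rcomm (freeL g) (freeR h)) (freeHat hq k) *
        (rcomm (freeL (rconj g (k ^ q))) (freeR (rconj h (k ^ q))))⁻¹)
  | hat_mul (hq : q ≠ 0) (k k₁ : G) :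
      NuRel ((freeHat hq k)⁻¹ * freeHat hq (k * k₁) * (freeHat hq k₁)⁻¹ *
        ((List.range (q - 1)).map fun j =>
          rconj (rcomm (freeL k) (freeR (k₁ ^ (j + 1))⁻¹))
            (freeL (k ^ (q - 1 - (j + 1))))).prod⁻¹)
  | comm_hat (hq : q ≠ 0) (k k₁ : G) :
      NuRel (rcomm (freeHat hq k) (freeHat hq k₁) *
        (rcomm (freeL (k ^ q)) (freeR (k₁ ^ q)))⁻¹)
  | hat_comm (hq : q ≠ 0) (g h : G) :
      NuRel (freeHat hq (rcomm g h) * (rcomm (freeL g) (freeR h) ^ q)⁻¹)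

/-- The group `ν^q(G)`. -/
abbrev Nu : Type _ := NuFree G q ⧸ Subgroup.normalClosure {x | NuRel G q x}

variable {G}

/-- The element `g` of `ν^q(G)`. -/
def nuL (g : G) : Nu G q := QuotientGroup.mk (freeL g)

/-- The element `g^φ` of `ν^q(G)`. -/
def nuR (g : G) : Nu G q := QuotientGroup.mk (freeR g)

variable {q} in
/-- The element `k̂` of `ν^q(G)`. -/
def nuHat (hq : q ≠ 0) (k : G) : Nu G q := QuotientGroup.mk (freeHat hq k)

variable (G) in
/-- The subgroup `Δ^q(G)` of `ν^q(G)` generated by all `[g, g^φ]`. -/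
def Delta : Subgroup (Nu G q) :=
  Subgroup.closure {x | ∃ g : G, x = rcomm (nuL q g) (nuR q g)}

end Nu

/-! ### The group `τ^q(G)` -/

section Tau

variable {n r : ℕ}

/-- The generators `g₁, …, gₙ, g₁^φ, …, gₙ^φ, w₁, …, w_r` of `τ^q(G)`, in this order. -/
abbrev TauGen (n r : ℕ) : Type := Fin n ⊕ₗ (Fin n ⊕ₗ Fin r)

/-- The generating symbol `g_i`. -/
def sG (i : Fin n) : TauGen n r := Sum.inlₗ i

/-- The generating symbol `g_i^φ`. -/
def sP (i : Fin n) : TauGen n r := Sum.inrₗ (Sum.inlₗ i)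

/-- The generating symbol `w_i`. -/
def sW (i : Fin r) : TauGen n r := Sum.inrₗ (Sum.inrₗ i)

/-- The letter `g_i` in the free group. -/
def xG (i : Fin n) : FreeGroup (TauGen n r) := FreeGroup.of (sG i)

/-- The letter `g_i^φ` in the free group. -/
def xP (i : Fin n) : FreeGroup (TauGen n r) := FreeGroup.of (sP i)

/-- The letter `w_i` in the free group. -/
def xW (i : Fin r) : FreeGroup (TauGen n r) := FreeGroup.of (sW i)

variable {G : Type*} [Group G] (q : ℕ) (P : PcPresentation (Fin n)) (Q : PcPresentation (Fin r))
  (g : Fin n → G) (w : Fin r → ExteriorSquare G q) (c : ExteriorSquare G q → Fin r → ℤ)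

/-- The word in `w₁, …, w_r` that the choice `c` of exponents assigns to `a : G ∧^q G`. -/
def wWord (a : ExteriorSquare G q) : FreeGroup (TauGen n r) := collect xW (c a)

/-- The relators of `τ^q(G)`; here `P` is the presentation of `G` on the generators `g`, `Q` the
one of `G ∧^q G` on the generators `w`, and `c` gives, for each element of `G ∧^q G`, the exponents
of a word in `w` that represents it. -/
inductive TauRel : FreeGroup (TauGen n r) → Prop
  | relG (x : FreeGroup (Fin n)) (hx : x ∈ P.rels) : TauRel (FreeGroup.map sG x)
  | relP (x : FreeGroup (Fin n)) (hx : x ∈ P.rels) : TauRel (FreeGroup.map sP x)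
  | relW (x : FreeGroup (Fin r)) (hx : x ∈ Q.rels) : TauRel (FreeGroup.map sW x)
  | mixed (i j : Fin n) :
      TauRel ((xG i)⁻¹ * xP j * xG i * (xP j * wWord q c (lam q (g i) (g j) 1)⁻¹)⁻¹)
  | mixedInv (i j : Fin n) (hi : i ∉ P.I) :
      TauRel (xG i * xP j * (xG i)⁻¹ * (xP j * wWord q c (lam q (g i)⁻¹ (g j) 1)⁻¹)⁻¹)
  | actG (i : Fin r) (j : Fin n) :
      TauRel ((xG j)⁻¹ * xW i * xG j * (wWord q c (act q (g j) (w i)))⁻¹)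
  | actGInv (i : Fin r) (j : Fin n) (hj : j ∉ P.I) :
      TauRel (xG j * xW i * (xG j)⁻¹ * (wWord q c (act q (g j)⁻¹ (w i)))⁻¹)
  | actP (i : Fin r) (j : Fin n) :
      TauRel ((xP j)⁻¹ * xW i * xP j * (wWord q c (act q (g j) (w i)))⁻¹)
  | actPInv (i : Fin r) (j : Fin n) (hj : j ∉ P.I) :
      TauRel (xP j * xW i * (xP j)⁻¹ * (wWord q c (act q (g j)⁻¹ (w i)))⁻¹)

/-- The set of relators of `τ^q(G)`. -/
def tauRels : Set (FreeGroup (TauGen n r)) := {x | TauRel q P Q g w c x}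

/-- The group `τ^q(G)`. -/
abbrev Tau : Type := PresentedGroup (tauRels q P Q g w c)

/-- The element `g_i` of `τ^q(G)`. -/
def tauG (i : Fin n) : Tau q P Q g w c := PresentedGroup.of (sG i)

/-- The element `g_i^φ` of `τ^q(G)`. -/
def tauP (i : Fin n) : Tau q P Q g w c := PresentedGroup.of (sP i)

/-- The element `w_i` of `τ^q(G)`. -/
def tauW (i : Fin r) : Tau q P Q g w c := PresentedGroup.of (sW i)

/-- The subgroup `W = ⟨w₁, …, w_r⟩` of `τ^q(G)`. -/
def subW : Subgroup (Tau q P Q g w c) := Subgroup.closure (Set.range (tauW q P Q g w c))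

end Tau

end QTau

open QTau

/-! The idea is to build by hand the group that the presentation of `τ^q(G)` ought to define, and to
read off all four claims there. The model `TauModel` is the set `G × G × (G ∧^q G)`, where `(x, y,
a)` stands for the product `x y^φ a` and the multiplication is forced by `a x = x a^x`, `a y^φ = y^φ
a^y` and `[x, y^φ] = x ∧ y`.

The crux is associativity. It reduces to the biderivation rules together with a Peiffer identity:
conjugation by `g ∧ h` is the action of `[g, h]`. On symbols `a ⊗ b` this comes from the two
expansions of a product tensor. On symbols `k̂` it is not a defining relation;
`thatE_conj_tens_eq_act` derives it by expanding the hat of `k z = z k^z`, with `z = [g, h]`, in two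
ways.

Given the model, `exists_tau_equiv_model` identifies it with `τ^q(G)`: the relators hold in the
model, and conversely the relations on generators extend to all of `G` and `G ∧^q G`, which gives an
inverse map. The projection to `G × G` then has kernel exactly the copy of `G ∧^q G`, which is `W`.
Consistency holds because a collected word evaluates to the triple of three collected words, each
with a unique reduced form.

For `ν^q(G)`, sending `g`, `g^φ`, `k̂` to their namesakes defines a map to the model that kills
`Δ^q(G)`. The model in turn maps to `ν^q(G) / Δ^q(G)`, and the composite is the quotient map, so the
kernel is precisely `Δ^q(G)` (`nuToModel_ker`). -/

namespace QTau

/-! ### The `q`-tensor square: action, commutator formulas, Peiffer identities. -/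

section Tensor

variable {G : Type*} [Group G] (q : ℕ)

theorem rconj_mul_right (a x y : G) : rconj a (x * y) = rconj (rconj a x) y := by
  simp only [rconj]; group

theorem rconj_one_right (a : G) : rconj a 1 = a := by simp [rconj]

@[simp]
theorem actTensor_tens (x g h : G) :
    actTensor q x (tens q g h) = tens q (rconj g x) (rconj h x) := by
  simp [actTensor, tens]

@[simp]
theorem actTensor_thatE (x k : G) : actTensor q x (thatE q k) = thatE q (rconj k x) := by
  by_cases hq : q = 0 <;> simp [thatE, hq, actTensor]

theorem tensorSquare_induction {p : TensorSquare G q → Prop} (t : TensorSquare G q)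
    (tens : ∀ g h, p (tens q g h)) (hat : ∀ k, p (thatE q k)) (one : p 1)
    (mul : ∀ a b, p a → p b → p (a * b)) (inv : ∀ a, p a → p a⁻¹) : p t := by
  have ht : t ∈ Subgroup.closure (Set.range (PresentedGroup.of (rels := {x | TensorRel G q x}))) := by
    rw [PresentedGroup.closure_range_of]; trivial
  induction ht using Subgroup.closure_induction with
  | mem x hx =>
    obtain ⟨y | y, rfl⟩ := hx
    · exact tens y.1 y.2
    · have := hat y.1
      rwa [thatE, dif_pos y.2] at this
  | one => exact one
  | mul x y _ _ hx hy => exact mul x y hx hy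
  | inv x _ hx => exact inv x hx

theorem tensorSquare_hom_ext {K : Type*} [Group K] {f f' : TensorSquare G q →* K}
    (h : ∀ x y, f (tens q x y) = f' (tens q x y)) (h' : ∀ k, f (thatE q k) = f' (thatE q k)) :
    f = f' := by
  refine MonoidHom.ext fun t => ?_
  induction t using tensorSquare_induction with
  | tens g k => exact h g k
  | hat k => exact h' k
  | one => simp
  | mul a b ha hb => rw [map_mul, map_mul, ha, hb]
  | inv a ha => rw [map_inv, map_inv, ha]

theorem actTensor_mul (x y : G) (t : TensorSquare G q) :
    actTensor q (x * y) t = actTensor q y (actTensor q x t) := by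
  rw [← MonoidHom.comp_apply]
  congr 1
  apply tensorSquare_hom_ext <;> simp [rconj_mul_right]

theorem actTensor_one (t : TensorSquare G q) : actTensor q 1 t = t := by
  conv_rhs => rw [← MonoidHom.id_apply _ t]
  congr 1
  apply tensorSquare_hom_ext <;> simp [rconj_one_right]

theorem tens_one_left (h : G) : tens q 1 h = 1 := by
  have := tens_mul_left q 1 1 h
  simpa [rconj] using this

theorem tens_one_right (g : G) : tens q g 1 = 1 := by
  have := tens_mul_right q g 1 1
  simpa [rconj] using this

theorem tens_mul_left' (g g₁ h : G) :
    tens q (g * g₁) h = actTensor q g₁ (tens q g h) * tens q g₁ h := by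
  rw [tens_mul_left, actTensor_tens]

theorem tens_mul_right' (g h h₁ : G) :
    tens q g (h * h₁) = tens q g h₁ * actTensor q h₁ (tens q g h) := by
  rw [tens_mul_right, actTensor_tens]

theorem tens_conj_tens' (a c b d : G) :
    rconj (tens q a c) (tens q b d) = actTensor q (rcomm b d) (tens q a c) := by
  rw [tens_conj_tens, actTensor_tens]

theorem thatE_conj_tens (hq : q ≠ 0) (g h k : G) :
    rconj (tens q g h) (thatE q k) = actTensor q (k ^ q) (tens q g h) := by
  rw [actTensor_tens, ← tens_conj_hat q hq, thatE, dif_pos hq]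

theorem thatE_mul (hq : q ≠ 0) (k k₁ : G) :
    thatE q (k * k₁) = thatE q k * ((List.range (q - 1)).map fun j =>
      actTensor q (k ^ (q - 1 - (j + 1))) (tens q k (k₁ ^ (j + 1))⁻¹)).prod * thatE q k₁ := by
  have := mk_eq_of_rel q (TensorRel.hat_mul hq k k₁)
  simp only [map_mul, map_list_prod, List.map_map, Function.comp_def] at this
  simp only [actTensor_tens, thatE, dif_pos hq]
  exact this

theorem thatE_comm (hq : q ≠ 0) (k k₁ : G) :
    rcomm (thatE q k) (thatE q k₁) = tens q (k ^ q) (k₁ ^ q) := by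
  simp only [thatE, dif_pos hq]
  simpa only [rcomm, map_mul, map_inv] using! mk_eq_of_rel q (TensorRel.comm_hat hq k k₁)

theorem thatE_rcomm (hq : q ≠ 0) (g h : G) :
    thatE q (rcomm g h) = tens q g h ^ q := by
  simp only [thatE, dif_pos hq]
  simpa only [map_pow] using! mk_eq_of_rel q (TensorRel.hat_comm hq g h)

theorem thatE_one : thatE q (1 : G) = 1 := by
  by_cases hq : q = 0
  · simp [thatE, hq]
  · have := thatE_mul q hq (1 : G) 1
    simpa [tens_one_left, List.map_const'] using this

/-- `[g, h] ⊗ k = (g ⊗ h)⁻¹ (g ⊗ h) ^ k`. -/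
theorem tens_rcomm_left (g h k : G) :
    tens q (rcomm g h) k = (tens q g h)⁻¹ * actTensor q k (tens q g h) := by
  have h1 : actTensor q g (tens q g⁻¹ k) = (tens q g k)⁻¹ := by
    have := tens_mul_left' q g⁻¹ g k
    rw [inv_mul_cancel, tens_one_left] at this
    exact (inv_eq_of_mul_eq_one_left this.symm).symm
  have h2 : rcomm g h = g⁻¹ * rconj g h := by simp only [rcomm, rconj]; group
  -- Since `g^h = g [g, h]`, acting by `g^h` is acting by `g` and then conjugating by `g ⊗ h`.
  have h3 : actTensor q (rconj g h) (tens q g⁻¹ k) =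
      (tens q g h)⁻¹ * (tens q g k)⁻¹ * tens q g h := by
    have : rconj g h = g * rcomm g h := by simp only [rcomm, rconj]; group
    rw [this, actTensor_mul, h1, map_inv, ← tens_conj_tens', rconj]; group
  -- Both sides equal `g ⊗ hk`, the right one through `hk = (h k h⁻¹) h`.
  have h4 : tens q g k * actTensor q k (tens q g h) = tens q g h * tens q (rconj g h) k := by
    rw [← tens_mul_right']
    have := tens_mul_right' q g (h * k * h⁻¹) h
    rw [actTensor_tens] at this
    simpa [rconj, mul_assoc] using this
  rw [h2, tens_mul_left', h3, eq_inv_mul_iff_mul_eq.mpr h4]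
  group

/-- `k ⊗ [g, h] = ((g ⊗ h) ^ k)⁻¹ (g ⊗ h)`. -/
theorem tens_rcomm_right (g h k : G) :
    tens q k (rcomm g h) = (actTensor q k (tens q g h))⁻¹ * tens q g h := by
  have h1 (k : G) : actTensor q h (tens q k h⁻¹) = (tens q k h)⁻¹ := by
    have := tens_mul_right' q k h⁻¹ h
    rw [inv_mul_cancel, tens_one_right] at this
    exact (inv_eq_of_mul_eq_one_right this.symm).symm
  have h2 : rcomm g h = rconj h⁻¹ g * h := by simp only [rcomm, rconj]
  have h3 : actTensor q h (tens q k (rconj h⁻¹ g)) =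
      (tens q g h)⁻¹ * (tens q k (rconj h g))⁻¹ * tens q g h := by
    have e1 : tens q k (rconj h⁻¹ g) = actTensor q g (tens q (rconj k g⁻¹) h⁻¹) := by
      rw [actTensor_tens, ← rconj_mul_right, inv_mul_cancel, rconj_one_right]
    have e2 : g * h = h * (g * rcomm g h) := by simp only [rcomm]; group
    rw [e1, ← actTensor_mul, e2, actTensor_mul, h1, map_inv, actTensor_mul, actTensor_tens,
      ← rconj_mul_right, inv_mul_cancel, rconj_one_right, ← tens_conj_tens', rconj]
    group
  -- Both sides equal `gk ⊗ h`, the right one through `gk = (g k g⁻¹) g`.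
  have h4 : actTensor q k (tens q g h) * tens q k h = tens q k (rconj h g) * tens q g h := by
    rw [← tens_mul_left']
    have := tens_mul_left' q (g * k * g⁻¹) g h
    rw [actTensor_tens] at this
    simpa [rconj, mul_assoc] using this
  rw [h2, tens_mul_right', h3, eq_inv_mul_iff_mul_eq.mpr h4]
  group

/-- Evaluates the factors `k ⊗ z⁻ⁱ`, for `z` a commutator, that occur in the expansion of the hat of
`k z`. The powers accumulate because `z⁻¹` acts on tensors as conjugation by `(g ⊗ h)⁻¹`. -/
theorem tens_rcomm_pow_inv_right (g h k : G) (i : ℕ) :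
    tens q k (rcomm g h ^ i)⁻¹ = actTensor q k (tens q g h) ^ i * (tens q g h ^ i)⁻¹ := by
  have hz (s : G) : actTensor q (rcomm g h)⁻¹ (tens q k s) =
      tens q g h * tens q k s * (tens q g h)⁻¹ := by
    have e : rconj (actTensor q (rcomm g h)⁻¹ (tens q k s)) (tens q g h) = tens q k s := by
      rw [actTensor_tens, tens_conj_tens', ← actTensor_tens, ← actTensor_mul, inv_mul_cancel,
        actTensor_one]
    rw [eq_mul_inv_iff_mul_eq, eq_comm, ← eq_inv_mul_iff_mul_eq, ← mul_assoc]
    exact e.symm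
  have h1 : tens q k (rcomm g h)⁻¹ = actTensor q k (tens q g h) * (tens q g h)⁻¹ := by
    have := tens_mul_right' q k (rcomm g h) (rcomm g h)⁻¹
    rw [mul_inv_cancel, tens_one_right, hz, tens_rcomm_right] at this
    rw [eq_comm, mul_eq_one_iff_eq_inv] at this
    rw [this]; group
  induction i with
  | zero => simp [tens_one_right]
  | succ i ih =>
    rw [pow_succ' (rcomm g h), ← pow_succ', pow_succ (rcomm g h), mul_inv_rev]
    have := tens_mul_right' q k (rcomm g h ^ i)⁻¹ (rcomm g h)⁻¹
    rw [← mul_inv_rev, hz, h1, ih] at this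
    rw [← mul_inv_rev, ← pow_succ, pow_succ', this, pow_succ', pow_succ (tens q g h)]
    group

theorem actTensor_rcomm_pow (g h a b : G) (m : ℕ) :
    actTensor q (rcomm g h ^ m) (tens q a b) =
      (tens q g h ^ m)⁻¹ * tens q a b * tens q g h ^ m := by
  induction m generalizing a b with
  | zero => simp [rconj_one_right]
  | succ m ih =>
    rw [pow_succ', actTensor_mul, actTensor_tens, ih, ← tens_conj_tens, rconj, pow_succ']
    group

/-- The Peiffer identity for a symbol `k̂` and `g ⊗ h`. -/
theorem thatE_conj_tens_eq_act (g h k : G) :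
    rconj (thatE q k) (tens q g h) = actTensor q (rcomm g h) (thatE q k) := by
  obtain rfl | ⟨p, rfl⟩ : q = 0 ∨ ∃ p, q = p + 1 := by
    cases q <;> simp
  · simp [thatE, rconj]
  have hq : p + 1 ≠ 0 := p.succ_ne_zero
  set z := rcomm g h with hz
  set t := tens (p + 1) g h with ht
  -- All factors below are expressed through the translates of `t` by powers of `k`; integer
  -- exponents are needed because `k⁻ⁱ` occurs.
  let u : ℤ → TensorSquare G (p + 1) := fun j => actTensor (p + 1) (k ^ j) t
  have hu0 : u 0 = t := by simp [u, actTensor_one]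
  have hu (m : ℕ) (j : ℤ) : actTensor (p + 1) (k ^ m) (u j) = u (j + m) := by
    simp only [u]
    rw [← actTensor_mul, zpow_add, zpow_natCast]
  -- The hat of this one element is expanded along both factorizations. As `z` is a commutator, its
  -- own hat is `t ^ q`, so `k̂` and the hat of `k^z` are the only hats left.
  have e1 : z * rconj k z = k * z := by simp [rconj, mul_assoc]
  have e2 := thatE_mul (p + 1) hq z (rconj k z)
  rw [e1, thatE_mul (p + 1) hq k z, hz, thatE_rcomm (p + 1) hq, ← hz, ← ht] at e2
  simp only [Nat.add_sub_cancel] at e2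
  -- The `i`-th factor is `t⁻¹ u(-i)` conjugated by `t ^ (q - i)`, so each factor uses up one power
  -- of `t` and releases `u(-i)`.
  have hA : ∀ m ≤ p, t ^ (p + 1) * ((List.range m).map fun j =>
      actTensor (p + 1) (z ^ (p - (j + 1)))
        (tens (p + 1) z (rconj k z ^ (j + 1))⁻¹)).prod =
      ((List.range m).map fun j : ℕ => u (-(j + 1 : ℕ))).prod * t ^ (p + 1 - m) := by
    intro m hm
    induction m with
    | zero => simp
    | succ m ih =>
      rw [List.range_succ, List.map_append, List.prod_append, ← mul_assoc, ih (by omega),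
        List.map_append, List.prod_append]
      have e3 : tens (p + 1) z (rconj k z ^ (m + 1))⁻¹ =
          actTensor (p + 1) z (tens (p + 1) z (k ^ (m + 1))⁻¹) := by
        rw [actTensor_tens, rconj_inv, rconj_pow]
        simp [rconj]
      have e4 : p + 1 - m = (p - (m + 1)) + 1 + 1 := by omega
      have e5 : p + 1 - (m + 1) = (p - (m + 1)) + 1 := by omega
      simp only [List.map_cons, List.map_nil, List.prod_cons, List.prod_nil, mul_one]
      rw [e3, ← actTensor_mul, ← pow_succ', hz, actTensor_rcomm_pow, tens_rcomm_left, ← ht, e4, e5]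
      have e6 : actTensor (p + 1) (k ^ (m + 1))⁻¹ t = u (-(m + 1 : ℕ)) := by
        simp only [u]; rw [zpow_neg, zpow_natCast]
      rw [e6, pow_succ t (p - (m + 1) + 1)]
      group
  -- The `i`-th factor is `u(p-i+1)^i u(p-i)^(-i)`, so successive factors cancel down to one power
  -- of each `u`.
  have hB : ∀ m ≤ p, ((List.range m).map fun j =>
      actTensor (p + 1) (k ^ (p - (j + 1)))
        (tens (p + 1) k (z ^ (j + 1))⁻¹)).prod =
      ((List.range m).map fun j : ℕ => u ((p : ℤ) - j)).prod * (u ((p : ℤ) - m) ^ m)⁻¹ := by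
    intro m hm
    induction m with
    | zero => simp
    | succ m ih =>
      rw [List.range_succ, List.map_append, List.prod_append, ih (by omega),
        List.map_append, List.prod_append]
      simp only [List.map_cons, List.map_nil, List.prod_cons, List.prod_nil, mul_one]
      have e4 : (p : ℤ) - m = 1 + (p - (m + 1) : ℕ) := by omega
      have e5 : (p : ℤ) - (m + 1 : ℕ) = 0 + (p - (m + 1) : ℕ) := by omega
      have e6 : actTensor (p + 1) k t = u 1 := by simp [u]
      rw [hz, tens_rcomm_pow_inv_right, ← ht, map_mul, map_pow, map_inv, map_pow, e6, hu,
        ← hu0, hu, e4, e5, pow_succ' (u (1 + _))]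
      group
  rw [hB p le_rfl, hA p le_rfl] at e2
  -- Conjugation by `k̂` acts on tensors as `k ^ q`, so carrying `k̂` to the right lowers each index
  -- by `q = p + 1`.
  have hC : ∀ m : ℕ, ∀ f : ℕ → ℤ, thatE (p + 1) k * ((List.range m).map fun j => u (f j)).prod =
      ((List.range m).map fun j => u (f j - (p + 1 : ℕ))).prod * thatE (p + 1) k := by
    intro m f
    induction m with
    | zero => simp
    | succ m ih =>
      rw [List.range_succ, List.map_append, List.prod_append, ← mul_assoc, ih,
        List.map_append, List.prod_append]
      simp only [List.map_cons, List.map_nil, List.prod_cons, List.prod_nil, mul_one]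
      have e3 : rconj (u (f m - (p + 1 : ℕ))) (thatE (p + 1) k) = u (f m) := by
        simp only [u, ht]
        rw [actTensor_tens, thatE_conj_tens _ hq, ← actTensor_tens, ← actTensor_mul,
          ← zpow_natCast, ← zpow_add, sub_add_cancel]
      rw [← e3, rconj]; group
  rw [sub_self, hu0] at e2
  rw [actTensor_thatE, rconj]
  -- The shift by `q` turns `u(p) ⋯ u(1)` into `u(-1) ⋯ u(-p)`, exactly the product from `hA`, which
  -- then cancels.
  have e7 : thatE (p + 1) k * (((List.range p).map fun j : ℕ => u ((p : ℤ) - j)).prod * t) =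
      ((List.range p).map fun j : ℕ => u (-(j + 1 : ℕ))).prod * thatE (p + 1) k * t := by
    rw [← mul_assoc, hC]
    congr 5
    funext j
    congr 1
    push_cast; ring
  have e8 : (t ^ p)⁻¹ * t ^ (p + 1) = t := by rw [pow_succ]; group
  have e9 : p + 1 - p = 1 := by omega
  rw [mul_assoc, mul_assoc, mul_assoc, e8, e7, e9, pow_one, mul_assoc,
    mul_right_inj] at e2
  rw [mul_assoc, e2, inv_mul_cancel_left]

/-- The Peiffer identity for an element of `G ⊗^q G` and `g ⊗ h`. -/
theorem rconj_tens_eq_act (a : TensorSquare G q) (g h : G) :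
    rconj a (tens q g h) = actTensor q (rcomm g h) a := by
  induction a using tensorSquare_induction with
  | tens a b => exact tens_conj_tens' q a b g h
  | hat k => exact thatE_conj_tens_eq_act q g h k
  | one => simp [rconj]
  | mul a b ha hb => rw [rconj_mul, map_mul, ha, hb]
  | inv a ha => rw [rconj_inv, map_inv, ha]

/-! ### The `q`-exterior square -/

theorem act_mul (x y : G) (a : ExteriorSquare G q) : act q (x * y) a = act q y (act q x a) := by
  induction a using QuotientGroup.induction_on with
  | H t => exact congrArg QuotientGroup.mk (actTensor_mul q x y t)

@[simp]
theorem act_one (a : ExteriorSquare G q) : act q 1 a = a := by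
  induction a using QuotientGroup.induction_on with
  | H t => exact congrArg QuotientGroup.mk (actTensor_one q t)

theorem act_wedge (x g h : G) : act q x (wedge q g h) = wedge q (rconj g x) (rconj h x) :=
  congrArg QuotientGroup.mk (actTensor_tens q x g h)

theorem act_hatE (x k : G) : act q x (hatE q k) = hatE q (rconj k x) :=
  congrArg QuotientGroup.mk (actTensor_thatE q x k)

theorem wedge_mul_left (g g₁ h : G) :
    wedge q (g * g₁) h = act q g₁ (wedge q g h) * wedge q g₁ h :=
  congrArg QuotientGroup.mk (tens_mul_left' q g g₁ h)

theorem wedge_mul_right (g h h₁ : G) :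
    wedge q g (h * h₁) = wedge q g h₁ * act q h₁ (wedge q g h) :=
  congrArg QuotientGroup.mk (tens_mul_right' q g h h₁)

theorem wedge_one_left (h : G) : wedge q 1 h = 1 :=
  congrArg QuotientGroup.mk (tens_one_left q h)

theorem wedge_one_right (g : G) : wedge q g 1 = 1 :=
  congrArg QuotientGroup.mk (tens_one_right q g)

theorem wedge_self (g : G) : wedge q g g = 1 :=
  (QuotientGroup.eq_one_iff _).2 (Subgroup.subset_closure ⟨g, rfl⟩)

theorem hatE_one : hatE q (1 : G) = 1 :=
  congrArg QuotientGroup.mk (thatE_one q)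

theorem rconj_wedge_eq_act (a : ExteriorSquare G q) (g h : G) :
    rconj a (wedge q g h) = act q (rcomm g h) a := by
  induction a using QuotientGroup.induction_on with
  | H t => exact congrArg QuotientGroup.mk (rconj_tens_eq_act q t g h)

theorem hatE_conj_wedge (hq : q ≠ 0) (g h k : G) :
    rconj (wedge q g h) (hatE q k) = act q (k ^ q) (wedge q g h) :=
  congrArg QuotientGroup.mk (thatE_conj_tens q hq g h k)

theorem hatE_mul (hq : q ≠ 0) (k k₁ : G) :
    hatE q (k * k₁) = hatE q k * ((List.range (q - 1)).map fun j =>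
      act q (k ^ (q - 1 - (j + 1))) (wedge q k (k₁ ^ (j + 1))⁻¹)).prod * hatE q k₁ := by
  have := congrArg (QuotientGroup.mk' (nabla G q)) (thatE_mul q hq k k₁)
  rwa [map_mul, map_mul, map_list_prod, List.map_map] at this

theorem hatE_comm (hq : q ≠ 0) (k k₁ : G) :
    rcomm (hatE q k) (hatE q k₁) = wedge q (k ^ q) (k₁ ^ q) :=
  congrArg QuotientGroup.mk (thatE_comm q hq k k₁)

theorem hatE_rcomm (hq : q ≠ 0) (g h : G) : hatE q (rcomm g h) = wedge q g h ^ q :=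
  congrArg QuotientGroup.mk (thatE_rcomm q hq g h)

theorem lam_one_right (g h : G) : lam q g h 1 = wedge q g h := by
  rw [lam, hatE_one, mul_one]

theorem lam_one_left (k : G) : lam q 1 1 k = hatE q k := by
  rw [lam, wedge_one_left, one_mul]

end Tensor
-- The model of `τ^q(G)` on triples, and its universal property.
section Model

variable (G : Type*) [Group G] (q : ℕ)

/-- The underlying set of the iterated semidirect product `(G ∧^q G) ⋊ G ⋊ G`: the triple
`(x, y, a)` stands for the product `x y^φ a`, where `[x, y^φ] = x ∧ y`. -/
@[ext]
structure TauModel where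
  left : G
  right : G
  base : ExteriorSquare G q

namespace TauModel

variable {G q}

/-- The formula collects `x y^φ a · x' y'^φ a'`: moving `x'` left past `a` replaces `a` by `a^x'`,
moving it past `y^φ` leaves `(x' ∧ y)⁻¹`, and moving `y'^φ` left acts on both. -/
instance : Mul (TauModel G q) :=
  ⟨fun m m' => ⟨m.left * m'.left, m.right * m'.right,
    act q m'.right ((wedge q m'.left m.right)⁻¹ * act q m'.left m.base) * m'.base⟩⟩

instance : One (TauModel G q) := ⟨⟨1, 1, 1⟩⟩

/-- This collects `a⁻¹ (y^φ)⁻¹ x⁻¹`, using `(x⁻¹ ∧ y⁻¹)⁻¹ = (x ∧ y⁻¹)^(x⁻¹)`. -/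
instance : Inv (TauModel G q) :=
  ⟨fun m => ⟨m.left⁻¹, m.right⁻¹,
    act q m.left⁻¹ (wedge q m.left m.right⁻¹ * act q m.right⁻¹ m.base⁻¹)⟩⟩

theorem mul_def (m m' : TauModel G q) : m * m' = ⟨m.left * m'.left, m.right * m'.right,
    act q m'.right ((wedge q m'.left m.right)⁻¹ * act q m'.left m.base) * m'.base⟩ := rfl

theorem one_def : (1 : TauModel G q) = ⟨1, 1, 1⟩ := rfl

theorem inv_def (m : TauModel G q) : m⁻¹ = ⟨m.left⁻¹, m.right⁻¹,
    act q m.left⁻¹ (wedge q m.left m.right⁻¹ * act q m.right⁻¹ m.base⁻¹)⟩ := rfl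

instance : Group (TauModel G q) :=
  Group.ofLeftAxioms
    (by
      rintro ⟨x₁, y₁, a₁⟩ ⟨x₂, y₂, a₂⟩ ⟨x₃, y₃, a₃⟩
      simp only [mul_def]
      congr 1
      · exact mul_assoc ..
      · exact mul_assoc ..
      -- The only place where associativity needs more than the biderivation rules: the Peiffer
      -- identity, applied to `b` acted on by `y₂ x₃`, compares the actions of `y₂ x₃` and `x₃ y₂`.
      have key (b : ExteriorSquare G q) :
          act q x₃ (act q y₂ b) * wedge q x₃ y₂ =
            wedge q x₃ y₂ * act q y₂ (act q x₃ b) := by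
        have h := rconj_wedge_eq_act q (act q (y₂ * x₃) b) x₃ y₂
        rw [← act_mul, show y₂ * x₃ * rcomm x₃ y₂ = x₃ * y₂ by simp only [rcomm]; group,
          act_mul, act_mul, rconj] at h
        rw [← h]; group
      rw [← mul_assoc]
      congr 1
      rw [act_mul q y₂ y₃, ← map_mul, act_mul q x₂ x₃ a₁, wedge_mul_right, wedge_mul_left]
      simp only [map_mul, map_inv, mul_inv_rev, mul_assoc]
      congr 1
      have := congrArg (act q y₃) (key ((wedge q x₂ y₁)⁻¹ * act q x₂ a₁))
      rw [map_mul, map_mul _ (wedge q x₃ y₂), ← eq_mul_inv_iff_mul_eq, mul_assoc,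
        ← inv_mul_eq_iff_eq_mul] at this
      simp only [map_mul, map_inv, mul_assoc] at this
      simp only [← mul_assoc, mul_left_inj] at this ⊢
      exact this)
    (by
      rintro ⟨x, y, a⟩
      simp [mul_def, one_def, wedge_one_right])
    (by
      rintro ⟨x, y, a⟩
      simp only [mul_def, one_def, inv_def, ← act_mul, inv_mul_cancel, act_one,
        inv_mul_cancel_left, map_inv])

variable (G q) in
/-- The projection to `G × G`. -/
def toProd : TauModel G q →* G × G where
  toFun m := (m.left, m.right)
  map_one' := rfl
  map_mul' _ _ := rfl

variable (q) in
/-- The embedding of `G`. -/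
def inG : G →* TauModel G q where
  toFun x := ⟨x, 1, 1⟩
  map_one' := rfl
  map_mul' x y := by simp [mul_def, wedge_one_right]

variable (q) in
/-- The embedding of `G^φ`. -/
def inP : G →* TauModel G q where
  toFun x := ⟨1, x, 1⟩
  map_one' := rfl
  map_mul' x y := by simp [mul_def, wedge_one_left]

/-- The embedding of `G ∧^q G`. -/
def inE : ExteriorSquare G q →* TauModel G q where
  toFun a := ⟨1, 1, a⟩
  map_one' := rfl
  map_mul' x y := by simp [mul_def, wedge_one_left]

theorem inE_injective : Function.Injective (inE : ExteriorSquare G q → TauModel G q) :=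
  fun _ _ h => congrArg base h

theorem inG_mul_inP_mul_inE (x y : G) (a : ExteriorSquare G q) :
    inG q x * inP q y * inE a = ⟨x, y, a⟩ := by
  simp [inG, inP, inE, mul_def, wedge_one_left]

theorem toProd_eq_one {m : TauModel G q} (h : toProd G q m = 1) : m = inE m.base := by
  obtain ⟨x, y, a⟩ := m
  obtain ⟨rfl, rfl⟩ := Prod.mk.inj h
  rfl

theorem inE_mul_inG (a : ExteriorSquare G q) (x : G) :
    inE a * inG q x = inG q x * inE (act q x a) := by
  simp [inG, inE, mul_def, wedge_one_right]

theorem inE_mul_inP (a : ExteriorSquare G q) (x : G) :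
    inE a * inP q x = inP q x * inE (act q x a) := by
  simp [inP, inE, mul_def, wedge_one_left]

theorem rcomm_inG_inP (x y : G) : rcomm (inG q x) (inP q y) = inE (wedge q x y) := by
  have : inG q x * inP q y = inP q y * inG q x * inE (wedge q x y) := by
    simp [inG, inP, inE, mul_def, wedge_one_left]
  rw [rcomm, mul_assoc, this]
  group

section Lift

variable {K : Type*} [Group K] (fG fP : G →* K) (fE : ExteriorSquare G q →* K)

/-- A homomorphism from `TauModel G q` is given by homomorphisms from `G`, from `G^φ` and from
`G ∧^q G` that respect the conjugations and the commutators. -/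
def lift (hG : ∀ x a, fE a * fG x = fG x * fE (act q x a))
    (hP : ∀ x a, fE a * fP x = fP x * fE (act q x a))
    (hC : ∀ x y, rcomm (fG x) (fP y) = fE (wedge q x y)) : TauModel G q →* K :=
  MonoidHom.mk' (fun m => fG m.left * fP m.right * fE m.base) <| by
    rintro ⟨x, y, a⟩ ⟨x', y', a'⟩
    -- The rule for moving `x'` past `y^φ`, as in the multiplication of the model; the other two
    -- moves are `hG` and `hP`.
    have h : fG x' * fP y * fE (wedge q x' y)⁻¹ = fP y * fG x' := by
      rw [map_inv, ← hC, rcomm]; group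
    have h' : fP y * fG x' = fG x' * fP y * fE (wedge q x' y)⁻¹ := h.symm
    calc fG (x * x') * fP (y * y') *
          fE (act q y' ((wedge q x' y)⁻¹ * act q x' a) * a')
        = fG x * fG x' * fP y * (fP y' * fE (act q y' ((wedge q x' y)⁻¹ * act q x' a))) * fE a' := by
          simp only [map_mul, mul_assoc]
      _ = fG x * (fG x' * fP y * fE (wedge q x' y)⁻¹) * fE (act q x' a) * fP y' * fE a' := by
          rw [← hP, map_mul]; simp only [mul_assoc]
      _ = fG x * fP y * (fG x' * fE (act q x' a)) * fP y' * fE a' := by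
          rw [h]; simp only [mul_assoc]
      _ = fG x * fP y * fE a * (fG x' * fP y' * fE a') := by
          rw [← hG]; simp only [mul_assoc]

variable {fG fP fE} (hG : ∀ x a, fE a * fG x = fG x * fE (act q x a))
    (hP : ∀ x a, fE a * fP x = fP x * fE (act q x a))
    (hC : ∀ x y, rcomm (fG x) (fP y) = fE (wedge q x y))

@[simp]
theorem lift_inG (x : G) : lift fG fP fE hG hP hC (inG q x) = fG x := by
  simp [lift, inG]

@[simp]
theorem lift_inP (x : G) : lift fG fP fE hG hP hC (inP q x) = fP x := by
  simp [lift, inP]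

@[simp]
theorem lift_inE (a : ExteriorSquare G q) : lift fG fP fE hG hP hC (inE a) = fE a := by
  simp [lift, inE]

end Lift

theorem hom_ext {K : Type*} [Group K] {f f' : TauModel G q →* K}
    (hG : ∀ x, f (inG q x) = f' (inG q x)) (hP : ∀ x, f (inP q x) = f' (inP q x))
    (hE : ∀ a, f (inE a) = f' (inE a)) : f = f' := by
  ext ⟨x, y, a⟩
  rw [← inG_mul_inP_mul_inE, map_mul, map_mul, map_mul, map_mul, hG, hP, hE]

end TauModel

end Model
-- Maps between `ν^q(G)`, the model and `ν^q(G) / Δ^q(G)`.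
section Nu

variable {G : Type*} [Group G] (q : ℕ)

theorem nu_mk_eq_of_rel {a b : NuFree G q} (h : NuRel G q (a * b⁻¹)) :
    (QuotientGroup.mk a : Nu G q) = QuotientGroup.mk b := by
  have := (QuotientGroup.eq_one_iff (N := Subgroup.normalClosure {x | NuRel G q x}) _).2
    (Subgroup.subset_normalClosure h)
  rw [QuotientGroup.mk_mul, QuotientGroup.mk_inv] at this
  exact mul_inv_eq_one.mp this

variable (G) in
/-- The homomorphism `G → ν^q(G)`. -/
def nuLHom : G →* Nu G q :=
  (QuotientGroup.mk' _).comp (Monoid.Coprod.inl.comp Monoid.Coprod.inl)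

variable (G) in
/-- The homomorphism `G → G^φ → ν^q(G)`. -/
def nuRHom : G →* Nu G q :=
  (QuotientGroup.mk' _).comp (Monoid.Coprod.inl.comp Monoid.Coprod.inr)

theorem nuLHom_apply (g : G) : nuLHom G q g = nuL q g := rfl

theorem nuRHom_apply (g : G) : nuRHom G q g = nuR q g := rfl

theorem nu_left (g h k : G) : rconj (rcomm (nuL q g) (nuR q h)) (nuL q k) =
    rcomm (nuL q (rconj g k)) (nuR q (rconj h k)) :=
  nu_mk_eq_of_rel q (NuRel.left g h k)

theorem nu_right (g h k : G) : rconj (rcomm (nuL q g) (nuR q h)) (nuR q k) =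
    rcomm (nuL q (rconj g k)) (nuR q (rconj h k)) :=
  nu_mk_eq_of_rel q (NuRel.right g h k)

variable {q} in
theorem nu_hat_left (hq : q ≠ 0) (g k : G) :
    rconj (nuHat hq k) (nuL q g) = nuHat hq (rconj k g) :=
  nu_mk_eq_of_rel q (NuRel.hat_left hq g k)

variable {q} in
theorem nu_hat_right (hq : q ≠ 0) (g k : G) :
    rconj (nuHat hq k) (nuR q g) = nuHat hq (rconj k g) :=
  nu_mk_eq_of_rel q (NuRel.hat_right hq g k)

variable {q} in
theorem nu_conj_hat (hq : q ≠ 0) (g h k : G) :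
    rconj (rcomm (nuL q g) (nuR q h)) (nuHat hq k) =
      rcomm (nuL q (rconj g (k ^ q))) (nuR q (rconj h (k ^ q))) :=
  nu_mk_eq_of_rel q (NuRel.conj_hat hq g h k)

variable {q} in
theorem nu_hat_mul (hq : q ≠ 0) (k k₁ : G) :
    (nuHat hq k)⁻¹ * nuHat hq (k * k₁) * (nuHat hq k₁)⁻¹ =
      ((List.range (q - 1)).map fun j => rconj (rcomm (nuL q k) (nuR q (k₁ ^ (j + 1))⁻¹))
            (nuL q (k ^ (q - 1 - (j + 1))))).prod := by
  have := nu_mk_eq_of_rel q (NuRel.hat_mul hq k k₁)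
  rw [← QuotientGroup.mk'_apply, ← QuotientGroup.mk'_apply, map_list_prod, List.map_map] at this
  exact this

variable {q} in
theorem nu_comm_hat (hq : q ≠ 0) (k k₁ : G) :
    rcomm (nuHat hq k) (nuHat hq k₁) = rcomm (nuL q (k ^ q)) (nuR q (k₁ ^ q)) :=
  nu_mk_eq_of_rel q (NuRel.comm_hat hq k k₁)

variable {q} in
theorem nu_hat_comm (hq : q ≠ 0) (g h : G) :
    nuHat hq (rcomm g h) = rcomm (nuL q g) (nuR q h) ^ q :=
  nu_mk_eq_of_rel q (NuRel.hat_comm hq g h)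

theorem nu_hom_ext {K : Type*} [Group K] {f f' : Nu G q →* K}
    (hL : ∀ x, f (nuL q x) = f' (nuL q x)) (hR : ∀ x, f (nuR q x) = f' (nuR q x))
    (hH : ∀ k (hq : q ≠ 0), f (nuHat hq k) = f' (nuHat hq k)) : f = f' := by
  refine QuotientGroup.monoidHom_ext _ (Monoid.Coprod.hom_ext (Monoid.Coprod.hom_ext ?_ ?_) ?_)
  · exact MonoidHom.ext hL
  · exact MonoidHom.ext hR
  · exact FreeGroup.ext_hom _ _ fun k => hH k.1 k.2

/-- The homomorphism from the free product to the model of `τ^q(G)`. -/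
def nuFreeToModel : NuFree G q →* TauModel G q :=
  Monoid.Coprod.lift (Monoid.Coprod.lift (TauModel.inG q) (TauModel.inP q))
    (FreeGroup.lift fun k : HatSymbol G q => TauModel.inE (hatE q k.1))

@[simp]
theorem nuFreeToModel_freeL (x : G) : nuFreeToModel q (freeL x) = TauModel.inG q x := by
  simp [nuFreeToModel, freeL]

@[simp]
theorem nuFreeToModel_freeR (x : G) : nuFreeToModel q (freeR x) = TauModel.inP q x := by
  simp [nuFreeToModel, freeR]

@[simp]
theorem nuFreeToModel_freeHat (hq : q ≠ 0) (x : G) :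
    nuFreeToModel q (freeHat hq x) = TauModel.inE (hatE q x) := by
  simp [nuFreeToModel, freeHat]

theorem TauModel.rconj_inE_inG (a : ExteriorSquare G q) (x : G) :
    rconj (inE a) (inG q x) = inE (act q x a) := by
  rw [rconj, mul_assoc, inE_mul_inG, inv_mul_cancel_left]

theorem TauModel.rconj_inE_inP (a : ExteriorSquare G q) (x : G) :
    rconj (inE a) (inP q x) = inE (act q x a) := by
  rw [rconj, mul_assoc, inE_mul_inP, inv_mul_cancel_left]

/-- In the model `[g, h^φ]` is `g ∧ h`, and conjugation by `G` or `G^φ` is the action, so every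
relator becomes an identity already known in `G ∧^q G`. -/
theorem nuFreeToModel_of_rel {x : NuFree G q} (h : NuRel G q x) : nuFreeToModel q x = 1 := by
  cases h with
  | hat_mul hq k k₁ =>
    have h := congrArg TauModel.inE (hatE_mul q hq k k₁)
    rw [map_mul, map_mul, map_list_prod, List.map_map] at h
    simp only [map_mul, map_inv, mul_inv_eq_one, map_list_prod, List.map_map, Function.comp_def,
      map_rconj, map_rcomm, nuFreeToModel_freeL, nuFreeToModel_freeR, nuFreeToModel_freeHat] at h ⊢
    rw [h]
    simp only [TauModel.rcomm_inG_inP, TauModel.rconj_inE_inG,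
      ← map_inv (TauModel.inP q)]
    group
  | left g h k =>
    rw [map_mul, map_inv, mul_inv_eq_one, map_rconj, map_rcomm, map_rcomm]
    simp only [nuFreeToModel_freeL, nuFreeToModel_freeR, TauModel.rcomm_inG_inP,
      TauModel.rconj_inE_inG, act_wedge]
  | right g h k =>
    rw [map_mul, map_inv, mul_inv_eq_one, map_rconj, map_rcomm, map_rcomm]
    simp only [nuFreeToModel_freeL, nuFreeToModel_freeR, TauModel.rcomm_inG_inP,
      TauModel.rconj_inE_inP, act_wedge]
  | hat_left hq g k =>
    simp only [map_mul, map_inv, mul_inv_eq_one, map_rconj, nuFreeToModel_freeL,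
      nuFreeToModel_freeHat, TauModel.rconj_inE_inG, act_hatE]
  | hat_right hq g k =>
    simp only [map_mul, map_inv, mul_inv_eq_one, map_rconj, nuFreeToModel_freeR,
      nuFreeToModel_freeHat, TauModel.rconj_inE_inP, act_hatE]
  | conj_hat hq g h k =>
    rw [map_mul, map_inv, mul_inv_eq_one, map_rconj, map_rcomm, map_rcomm]
    simp only [nuFreeToModel_freeL, nuFreeToModel_freeR, nuFreeToModel_freeHat,
      TauModel.rcomm_inG_inP]
    rw [← map_rconj, hatE_conj_wedge q hq, act_wedge]
  | comm_hat hq k k₁ =>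
    simp only [map_mul, map_inv, mul_inv_eq_one, map_rcomm, nuFreeToModel_freeL,
      nuFreeToModel_freeR, nuFreeToModel_freeHat, TauModel.rcomm_inG_inP]
    rw [← map_rcomm, hatE_comm q hq]
  | hat_comm hq g h =>
    simp only [map_mul, map_inv, mul_inv_eq_one, map_pow, map_rcomm, nuFreeToModel_freeL,
      nuFreeToModel_freeR, nuFreeToModel_freeHat, TauModel.rcomm_inG_inP]
    rw [← map_pow, hatE_rcomm q hq]

/-- The homomorphism from `ν^q(G)` to the model of `τ^q(G)`. -/
def nuToModel : Nu G q →* TauModel G q :=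
  QuotientGroup.lift _ (nuFreeToModel q) <| by
    exact Subgroup.normalClosure_le_normal fun x hx => nuFreeToModel_of_rel q hx

@[simp]
theorem nuToModel_nuL (x : G) : nuToModel q (nuL q x) = TauModel.inG q x :=
  nuFreeToModel_freeL q x

@[simp]
theorem nuToModel_nuR (x : G) : nuToModel q (nuR q x) = TauModel.inP q x :=
  nuFreeToModel_freeR q x

@[simp]
theorem nuToModel_nuHat (hq : q ≠ 0) (x : G) :
    nuToModel q (nuHat hq x) = TauModel.inE (hatE q x) :=
  nuFreeToModel_freeHat q hq x

/-- Every element of `ν^q(G)` permutes the generators of `Δ^q(G)` by conjugation. -/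
theorem exists_nu_conj (t : Nu G q) : ∃ z : G, ∀ a c : G,
    rconj (rcomm (nuL q a) (nuR q c)) t = rcomm (nuL q (rconj a z)) (nuR q (rconj c z)) := by
  have hmul (x y : Nu G q) (hx : ∃ z : G, ∀ a c : G, rconj (rcomm (nuL q a) (nuR q c)) x =
      rcomm (nuL q (rconj a z)) (nuR q (rconj c z))) (hy : ∃ z : G, ∀ a c : G,
      rconj (rcomm (nuL q a) (nuR q c)) y = rcomm (nuL q (rconj a z)) (nuR q (rconj c z))) :
      ∃ z : G, ∀ a c : G, rconj (rcomm (nuL q a) (nuR q c)) (x * y) =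
        rcomm (nuL q (rconj a z)) (nuR q (rconj c z)) := by
    obtain ⟨z, hz⟩ := hx
    obtain ⟨z', hz'⟩ := hy
    exact ⟨z * z', fun a c => by simp only [rconj_mul_right, hz, hz']⟩
  induction t using QuotientGroup.induction_on with | H t =>
  induction t using Monoid.Coprod.induction_on with
  | inl t =>
    induction t using Monoid.Coprod.induction_on with
    | inl x => exact ⟨x, fun a c => nu_left q a c x⟩
    | inr x => exact ⟨x, fun a c => nu_right q a c x⟩
    | mul x y hx hy => rw [map_mul]; exact hmul _ _ hx hy
  | inr t =>
    induction t using FreeGroup.induction_on with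
    | C1 => exact ⟨1, fun a c => by simp [rconj]⟩
    | of k => exact ⟨k.1 ^ q, fun a c => nu_conj_hat k.2 a c k.1⟩
    | inv_of k _ =>
      -- The relation for `k̂` is applied to the arguments conjugated by `k^(-q)` and then undone by
      -- conjugating with `k̂⁻¹`.
      refine ⟨(k.1 ^ q)⁻¹, fun a c => ?_⟩
      have h := nu_conj_hat k.2 (rconj a (k.1 ^ q)⁻¹) (rconj c (k.1 ^ q)⁻¹) k.1
      rw [← rconj_mul_right, ← rconj_mul_right, inv_mul_cancel, rconj_one_right,
        rconj_one_right] at h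
      rw [← h, map_inv, QuotientGroup.mk_inv]
      change rconj (rconj _ (nuHat k.2 k.1)) (nuHat k.2 k.1)⁻¹ = _
      rw [← rconj_mul_right, mul_inv_cancel, rconj_one_right]
    | mul x y hx hy => rw [map_mul]; exact hmul _ _ hx hy
  | mul x y hx hy => exact hmul _ _ hx hy

instance Delta_normal : (Delta G q).Normal := by
  rw [Delta]
  apply Subgroup.Normal.mk
  intro n hn t
  obtain ⟨z, hz⟩ := exists_nu_conj q t⁻¹
  induction hn using Subgroup.closure_induction with
  | mem x hx =>
    obtain ⟨g, rfl⟩ := hx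
    refine Subgroup.subset_closure ⟨rconj g z, ?_⟩
    rw [← hz, rconj, inv_inv]
  | one => simp
  | mul x y _ _ hx hy =>
    rw [← conj_mul]; exact mul_mem hx hy
  | inv x _ hx =>
    rw [← conj_inv]; exact inv_mem hx

/-- The two product rules are the commutator identities for `[x, yz]` and `[xy, z]`, once conjugates
of `[g, h^φ]` are rewritten by the relations of `ν^q(G)`; the remaining relators are relations of
`ν^q(G)` in another form. -/
theorem nuToTensor_of_rel : ∀ x ∈ {x | TensorRel G q x},
    FreeGroup.lift (Sum.elim (fun p : G × G => rcomm (nuL q p.1) (nuR q p.2))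
      (fun k : HatSymbol G q => nuHat k.2 k.1)) x = 1 := by
  intro x hx
  have hT (g h : G) : FreeGroup.lift (Sum.elim (fun p : G × G => rcomm (nuL q p.1) (nuR q p.2))
      (fun k : HatSymbol G q => nuHat k.2 k.1)) (symT g h) = rcomm (nuL q g) (nuR q h) := by
    simp [symT]
  have hH (hq : q ≠ 0) (k : G) :
      FreeGroup.lift (Sum.elim (fun p : G × G => rcomm (nuL q p.1) (nuR q p.2))
      (fun k : HatSymbol G q => nuHat k.2 k.1)) (symHat hq k) = nuHat hq k := by
    simp [symHat]
  cases hx with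
  | right_mul g h h₁ =>
    rw [map_mul, map_inv, map_mul, hT, hT, hT, mul_inv_eq_one, ← nu_right, ← nuRHom_apply,
      ← nuRHom_apply, ← nuRHom_apply, map_mul]
    simp only [rcomm, rconj]; group
  | left_mul g g₁ h =>
    rw [map_mul, map_inv, map_mul, hT, hT, hT, mul_inv_eq_one, ← nu_left, ← nuLHom_apply,
      ← nuLHom_apply, ← nuLHom_apply, map_mul]
    simp only [rcomm, rconj]; group
  | conj_hat hq g h k =>
    rw [map_mul, map_inv, map_rconj, hT, hT, hH, mul_inv_eq_one, nu_conj_hat]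
  | hat_mul hq k k₁ =>
    simp only [map_mul, map_inv, map_list_prod, List.map_map, Function.comp_def, hT, hH,
      ← nu_left, mul_inv_eq_one]
    rw [← nu_hat_mul hq]
    group
  | comm_hat hq k k₁ =>
    rw [map_mul, map_inv, map_rcomm, hT, hH, hH, mul_inv_eq_one, nu_comm_hat]
  | hat_comm hq g h =>
    rw [map_mul, map_inv, map_pow, hT, hH, mul_inv_eq_one, nu_hat_comm]

/-- The homomorphism `G ⊗^q G → ν^q(G)` with `g ⊗ h ↦ [g, h^φ]` and `k̂ ↦ k̂`. -/
def tensorToNu : TensorSquare G q →* Nu G q := PresentedGroup.toGroup (nuToTensor_of_rel q)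

@[simp]
theorem tensorToNu_tens (g h : G) : tensorToNu q (tens q g h) = rcomm (nuL q g) (nuR q h) := by
  simp [tensorToNu, tens]

@[simp]
theorem tensorToNu_thatE (hq : q ≠ 0) (k : G) : tensorToNu q (thatE q k) = nuHat hq k := by
  simp [tensorToNu, thatE, hq]

/-- The homomorphism `G ∧^q G → ν^q(G) / Δ^q(G)`. -/
def extToNu : ExteriorSquare G q →* Nu G q ⧸ Delta G q :=
  QuotientGroup.map _ _ (tensorToNu q) <| (Subgroup.closure_le _).2 <| by
    rintro _ ⟨g, rfl⟩
    exact Subgroup.subset_closure ⟨g, tensorToNu_tens q g g⟩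

theorem tensorToNu_mul_nuL (x : G) (t : TensorSquare G q) :
    tensorToNu q t * nuL q x = nuL q x * tensorToNu q (actTensor q x t) := by
  suffices h : (MulAut.conj (nuL q x)⁻¹).toMonoidHom.comp (tensorToNu q) =
      (tensorToNu q).comp (actTensor q x) by
    rw [← MonoidHom.comp_apply, ← h]
    simp [mul_assoc]
  apply tensorSquare_hom_ext
  · intro g h
    simpa [rconj] using nu_left q g h x
  · intro k
    by_cases hq : q = 0
    · simp [thatE, hq]
    · simpa [rconj, hq] using nu_hat_left hq x k

theorem tensorToNu_mul_nuR (x : G) (t : TensorSquare G q) :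
    tensorToNu q t * nuR q x = nuR q x * tensorToNu q (actTensor q x t) := by
  suffices h : (MulAut.conj (nuR q x)⁻¹).toMonoidHom.comp (tensorToNu q) =
      (tensorToNu q).comp (actTensor q x) by
    rw [← MonoidHom.comp_apply, ← h]
    simp [mul_assoc]
  apply tensorSquare_hom_ext
  · intro g h
    simpa [rconj] using nu_right q g h x
  · intro k
    by_cases hq : q = 0
    · simp [thatE, hq]
    · simpa [rconj, hq] using nu_hat_right hq x k

/-- The homomorphism from the model of `τ^q(G)` to `ν^q(G) / Δ^q(G)`. -/
def modelToNu : TauModel G q →* Nu G q ⧸ Delta G q :=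
  TauModel.lift ((QuotientGroup.mk' _).comp (nuLHom G q)) ((QuotientGroup.mk' _).comp (nuRHom G q))
    (extToNu q)
    (fun x a => by
      induction a using QuotientGroup.induction_on with
      | H t => exact congrArg (QuotientGroup.mk' (Delta G q)) (tensorToNu_mul_nuL q x t))
    (fun x a => by
      induction a using QuotientGroup.induction_on with
      | H t => exact congrArg (QuotientGroup.mk' (Delta G q)) (tensorToNu_mul_nuR q x t))
    (fun x y => congrArg (QuotientGroup.mk' (Delta G q)) (tensorToNu_tens q x y).symm)

theorem modelToNu_comp_nuToModel :
    (modelToNu q).comp (nuToModel q) = QuotientGroup.mk' (Delta G q) := by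
  apply nu_hom_ext
  · intro x
    rw [MonoidHom.comp_apply, nuToModel_nuL]
    exact TauModel.lift_inG _ _ _ x
  · intro x
    rw [MonoidHom.comp_apply, nuToModel_nuR]
    exact TauModel.lift_inP _ _ _ x
  · intro k hq
    rw [MonoidHom.comp_apply, nuToModel_nuHat]
    refine (TauModel.lift_inE _ _ _ (hatE q k)).trans ?_
    exact congrArg (QuotientGroup.mk' (Delta G q)) (tensorToNu_thatE q hq k)

/-- The quotient map modulo `Δ^q(G)` factors through `nuToModel`, so the kernel is no larger than
`Δ^q(G)`; it contains `Δ^q(G)` because `g ∧ g = 1`. -/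
theorem nuToModel_ker : (nuToModel (G := G) q).ker = Delta G q := by
  apply le_antisymm
  · intro x hx
    rw [← QuotientGroup.ker_mk' (Delta G q), ← modelToNu_comp_nuToModel]
    rw [MonoidHom.mem_ker] at hx ⊢
    rw [MonoidHom.comp_apply, hx, map_one]
  · refine (Subgroup.closure_le _).2 ?_
    rintro _ ⟨g, rfl⟩
    rw [SetLike.mem_coe, MonoidHom.mem_ker, map_rcomm, nuToModel_nuL, nuToModel_nuR,
      TauModel.rcomm_inG_inP, wedge_self, map_one]

end Nu
/-! ### Collected words -/

section Collect

variable {X : Type*} [Fintype X] [LinearOrder X] {Y : Type*} [Fintype Y] [LinearOrder Y]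
  {H : Type*} [Group H] {K : Type*} [Group K]

theorem map_collect (f : H →* K) (x : X → H) (a : X → ℤ) :
    f (collect x a) = collect (fun i => f (x i)) a := by
  simp [collect, map_list_prod, Function.comp_def]

theorem map_collectAbove (f : H →* K) (i : X) (x : X → H) (a : X → ℤ) :
    f (collectAbove i x a) = collectAbove i (fun i => f (x i)) a := by
  simp [collectAbove, map_list_prod, Function.comp_def]

@[simp]
theorem collect_zero (x : X → H) : collect x 0 = 1 := by
  simp [collect, List.map_const']

theorem sort_filter_univ (p : X → Prop) [DecidablePred p] :
    (Finset.univ.filter p).sort (· ≤ ·) = (Finset.univ.sort (· ≤ ·)).filter (p ·) := by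
  have h := (List.toFinset_sort (l := ((Finset.univ : Finset X).sort (· ≤ ·)).filter (p ·)) (· ≤ ·)
    ((Finset.sort_nodup _ _).filter _)).2 ((Finset.pairwise_sort _ _).filter _)
  rw [← h]
  congr 1
  ext i
  simp

/-- Collecting above `i` is collecting with the exponents up to `i` replaced by `0`. -/
theorem collectAbove_eq_collect (i : X) (x : X → H) (a : X → ℤ) :
    collectAbove i x a = collect x fun k => if i < k then a k else 0 := by
  rw [collectAbove, collect, sort_filter_univ]
  generalize (Finset.univ : Finset X).sort (· ≤ ·) = l
  induction l with
  | nil => rfl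
  | cons k l ih =>
    by_cases h : i < k
    · simp [h, ih]
    · simp [h, ih]

theorem collect_single (x : X → H) (i : X) : collect x (Pi.single i 1) = x i := by
  have h (l : List X) (hl : l.Nodup) :
      (l.map fun k => x k ^ (Pi.single i 1 : X → ℤ) k).prod = if i ∈ l then x i else 1 := by
    induction l with
    | nil => rfl
    | cons k l ih =>
      rw [List.nodup_cons] at hl
      rw [List.map_cons, List.prod_cons, ih hl.2]
      by_cases hk : k = i
      · subst hk; simp [hl.1]
      · have hk' : i ≠ k := fun h => hk h.symm
        simp [hk, hk']
  rw [collect, h _ (Finset.sort_nodup _ _)]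
  simp

/-- In the lexicographic sum all of `X` precedes all of `Y`, so the increasing enumeration is the
concatenation of the two enumerations. This splits collected words of `τ^q(G)` into blocks. -/
theorem collect_lex (x : X ⊕ₗ Y → H) (a : X ⊕ₗ Y → ℤ) :
    collect x a = collect (fun i => x (Sum.inlₗ i)) (fun i => a (Sum.inlₗ i)) *
      collect (fun i => x (Sum.inrₗ i)) (fun i => a (Sum.inrₗ i)) := by
  have h : (Finset.univ : Finset (X ⊕ₗ Y)).sort (· ≤ ·) =
      ((Finset.univ : Finset X).sort (· ≤ ·)).map Sum.inlₗ ++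
      ((Finset.univ : Finset Y).sort (· ≤ ·)).map Sum.inrₗ := by
    have hl : Function.Injective (Sum.inlₗ : X → X ⊕ₗ Y) :=
      fun _ _ h => Sum.inl_injective (toLex.injective h)
    have hr : Function.Injective (Sum.inrₗ : Y → X ⊕ₗ Y) :=
      fun _ _ h => Sum.inr_injective (toLex.injective h)
    have hnd : (((Finset.univ : Finset X).sort (· ≤ ·)).map Sum.inlₗ ++
      ((Finset.univ : Finset Y).sort (· ≤ ·)).map Sum.inrₗ : List (X ⊕ₗ Y)).Nodup := by
      refine List.Nodup.append ((Finset.sort_nodup _ _).map hl) ((Finset.sort_nodup _ _).map hr) ?_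
      intro s hs ht
      obtain ⟨i, -, rfl⟩ := List.mem_map.1 hs
      obtain ⟨j, -, h⟩ := List.mem_map.1 ht
      exact Sum.inr_ne_inl (toLex.injective h)
    have hp : (((Finset.univ : Finset X).sort (· ≤ ·)).map Sum.inlₗ ++
      ((Finset.univ : Finset Y).sort (· ≤ ·)).map Sum.inrₗ : List (X ⊕ₗ Y)).Pairwise (· ≤ ·) := by
      refine List.pairwise_append.2 ⟨List.pairwise_map.2 ?_, List.pairwise_map.2 ?_, ?_⟩
      · exact (Finset.pairwise_sort _ _).imp fun h => Sum.Lex.inl_le_inl_iff.2 h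
      · exact (Finset.pairwise_sort _ _).imp fun h => Sum.Lex.inr_le_inr_iff.2 h
      · intro s hs t ht
        obtain ⟨i, -, rfl⟩ := List.mem_map.1 hs
        obtain ⟨j, -, rfl⟩ := List.mem_map.1 ht
        exact Sum.Lex.inl_le_inr i j
    rw [← (List.toFinset_sort (· ≤ ·) hnd).2 hp]
    congr 1
    ext s
    rcases s with i | j
    · exact iff_of_true (Finset.mem_univ _) (List.mem_toFinset.2 (List.mem_append.2
        (Or.inl (List.mem_map.2 ⟨i, by simp, rfl⟩))))
    · exact iff_of_true (Finset.mem_univ _) (List.mem_toFinset.2 (List.mem_append.2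
        (Or.inr (List.mem_map.2 ⟨j, by simp, rfl⟩))))
  rw [collect, h, List.map_append, List.prod_append, List.map_map, List.map_map]
  rfl

end Collect

/-! ### Groups given by polycyclic presentations -/

namespace PcPresentation

variable {X : Type*} [Fintype X] [LinearOrder X] {H : Type*} [Group H] {K : Type*} [Group K]
  {P : PcPresentation X} {x : X → H}

theorem Presents.lift_eq_one (h : P.Presents x) {s : FreeGroup X} (hs : s ∈ P.rels) :
    FreeGroup.lift x s = 1 := by
  obtain ⟨f, hf⟩ := h
  have : FreeGroup.lift x = f.toMonoidHom.comp (PresentedGroup.mk P.rels) := by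
    ext i
    simpa using! (hf i).symm
  rw [this, MonoidHom.comp_apply, PresentedGroup.one_of_mem hs, map_one]

theorem Presents.exists_hom (h : P.Presents x) (y : X → K)
    (hy : ∀ s ∈ P.rels, FreeGroup.lift y s = 1) : ∃ φ : H →* K, ∀ i, φ (x i) = y i := by
  obtain ⟨f, hf⟩ := h
  refine ⟨(PresentedGroup.toGroup hy).comp f.symm.toMonoidHom, fun i => ?_⟩
  rw [← hf]
  simp [gen]

theorem Presents.closure_range (h : P.Presents x) : Subgroup.closure (Set.range x) = ⊤ := by
  obtain ⟨f, hf⟩ := h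
  have : Set.range x = f.toMonoidHom '' Set.range (PresentedGroup.of (rels := P.rels)) := by
    rw [← Set.range_comp]
    exact congrArg _ (funext fun i => (hf i).symm)
  rw [this, ← MonoidHom.map_closure, PresentedGroup.closure_range_of]
  exact Subgroup.map_top_of_surjective _ f.surjective

theorem Presents.comp (h : P.Presents x) (f : H ≃* K) : P.Presents fun i => f (x i) := by
  obtain ⟨e, he⟩ := h
  exact ⟨e.trans f, fun i => by simp [he]⟩

theorem presents_of_rels_eq {R : Set (FreeGroup X)} (h : P.rels = R) :
    P.Presents fun i => (PresentedGroup.of i : PresentedGroup R) := by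
  subst h
  exact ⟨MulEquiv.refl _, fun _ => rfl⟩

/-- Lets unique reduced forms be tested in any group that the presentation defines, in particular in
`G`, in `G ∧^q G` and in the model. -/
theorem Presents.consistent_iff (h : P.Presents x) :
    P.Consistent ↔ ∀ s : H, ∃! a : X → ℤ, P.IsReduced a ∧ collect x a = s := by
  obtain ⟨f, hf⟩ := h
  have hx : x = fun i => f (P.gen i) := funext fun i => (hf i).symm
  have key (a : X → ℤ) (s : P.Grp) : collect x a = f s ↔ collect P.gen a = s := by
    rw [hx, ← MulEquiv.coe_toMonoidHom, ← map_collect, MulEquiv.coe_toMonoidHom,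
      f.apply_eq_iff_eq]
  rw [Consistent, f.toEquiv.forall_congr_right.symm]
  refine forall_congr' fun s => ?_
  simp only [MulEquiv.toEquiv_eq_coe, EquivLike.coe_coe, key]

end PcPresentation

/-! ### The isomorphism of `τ^q(G)` with its model. -/

section Tau

variable {n r : ℕ}

/-- A function on the generators of `τ^q(G)` from functions on the `g_i`, the `g_i^φ` and
the `w_i`. -/
def tauElim {C : Sort*} (a b : Fin n → C) (d : Fin r → C) : TauGen n r → C :=
  fun s => Sum.elim a (fun t => Sum.elim b d (ofLex t)) (ofLex s)

section Elim

variable {C : Sort*} (a b : Fin n → C) (d : Fin r → C)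

@[simp] theorem tauElim_sG (i : Fin n) : tauElim a b d (sG i) = a i := rfl

@[simp] theorem tauElim_sP (i : Fin n) : tauElim a b d (sP i) = b i := rfl

@[simp] theorem tauElim_sW (i : Fin r) : tauElim a b d (sW i) = d i := rfl

theorem tauGen_cases {p : TauGen n r → Prop} (s : TauGen n r) (hG : ∀ i, p (sG i))
    (hP : ∀ i, p (sP i)) (hW : ∀ i, p (sW i)) : p s := by
  rcases s with i | i | i
  · exact hG i
  · exact hP i
  · exact hW i

end Elim

variable {G : Type*} [Group G] (q : ℕ) {P : PcPresentation (Fin n)} {Q : PcPresentation (Fin r)}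
  {g : Fin n → G} {w : Fin r → ExteriorSquare G q} {c : ExteriorSquare G q → Fin r → ℤ}

theorem map_wWord {K : Type*} [Group K] (f : TauGen n r → K) (a : ExteriorSquare G q) :
    FreeGroup.lift f (wWord q c a) = collect (fun i => f (sW i)) (c a) := by
  simp [wWord, map_collect, xW]

theorem lift_map {X Y K : Type*} [Group K] (f : Y → K) (s : X → Y) (x : FreeGroup X) :
    FreeGroup.lift f (FreeGroup.map s x) = FreeGroup.lift (fun i => f (s i)) x := by
  rw [← MonoidHom.comp_apply]
  congr 1
  ext i
  simp

section ToModel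

open TauModel

variable (g w) in
/-- The images in the model of the generators of `τ^q(G)`. -/
def modelGen : TauGen n r → TauModel G q :=
  tauElim (fun i => inG q (g i)) (fun i => inP q (g i)) (fun i => inE (w i))

theorem lift_modelGen_wWord (hc : ∀ a, collect w (c a) = a) (a : ExteriorSquare G q) :
    FreeGroup.lift (modelGen q g w) (wWord q c a) = inE a := by
  conv_rhs => rw [← hc a, map_collect]
  exact map_wWord q _ a

theorem lift_modelGen_eq_one (hPG : P.Presents g) (hQA : Q.Presents w)
    (hc : ∀ a, collect w (c a) = a) :
    ∀ x ∈ tauRels q P Q g w c, FreeGroup.lift (modelGen q g w) x = 1 := by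
  have eG (i : Fin n) : FreeGroup.lift (modelGen q g w) (xG i) = inG q (g i) := by
    simp [xG, modelGen]
  have eP (i : Fin n) : FreeGroup.lift (modelGen q g w) (xP i) = inP q (g i) := by
    simp [xP, modelGen]
  have eW (i : Fin r) : FreeGroup.lift (modelGen q g w) (xW i) = inE (w i) := by
    simp [xW, modelGen]
  have eC := lift_modelGen_wWord q (g := g) hc
  have eL {X K : Type _} [Group K] (f : K →* TauModel G q) (y : X → K) (x : FreeGroup X)
      (hx : FreeGroup.lift y x = 1) : FreeGroup.lift (fun i => f (y i)) x = 1 := by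
    rw [← map_one f, ← hx, ← MonoidHom.comp_apply]
    congr 1
    exact FreeGroup.ext_hom _ _ fun i => by simp
  -- Stated for all `x` so that it serves both mixed families of relators, with `x = g i` and `x =
  -- (g i)⁻¹`.
  have conjC (x y : G) : (inG q x)⁻¹ * inP q y * inG q x = inP q y * inE (wedge q x y)⁻¹ := by
    rw [map_inv, ← rcomm_inG_inP, rcomm]; group
  intro x hx
  cases hx with
  | relG x hx => rw [lift_map]; exact eL (inG q) g x (hPG.lift_eq_one hx)
  | relP x hx => rw [lift_map]; exact eL (inP q) g x (hPG.lift_eq_one hx)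
  | relW x hx => rw [lift_map]; exact eL inE w x (hQA.lift_eq_one hx)
  | mixed i j =>
    simp only [map_mul, map_inv, eG, eP, eC, lam_one_right]
    rw [← map_inv inE, conjC, mul_inv_cancel]
  | mixedInv i j hi =>
    simp only [map_mul, map_inv, eG, eP, eC, lam_one_right]
    rw [← map_inv inE, ← conjC, map_inv, inv_inv, mul_inv_cancel]
  | actG i j =>
    simp only [map_mul, map_inv, eG, eW, eC]
    rw [← rconj_inE_inG, rconj, mul_inv_cancel]
  | actGInv i j hj =>
    simp only [map_mul, map_inv, eG, eW, eC]
    rw [← rconj_inE_inG, rconj, map_inv, inv_inv, mul_inv_cancel]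
  | actP i j =>
    simp only [map_mul, map_inv, eP, eW, eC]
    rw [← rconj_inE_inP, rconj, mul_inv_cancel]
  | actPInv i j hj =>
    simp only [map_mul, map_inv, eP, eW, eC]
    rw [← rconj_inE_inP, rconj, map_inv, inv_inv, mul_inv_cancel]

end ToModel

section FromModel

variable {K : Type*} [Group K] {fE : ExteriorSquare G q →* K}

/-- Compatibility with the action need only be checked on generators. -/
theorem hom_mul_eq_mul_act (hg : Subgroup.closure (Set.range g) = ⊤)
    (hw : Subgroup.closure (Set.range w) = ⊤) (f : G →* K)
    (h : ∀ i j, fE (w i) * f (g j) = f (g j) * fE (act q (g j) (w i))) (x : G)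
    (a : ExteriorSquare G q) : fE a * f x = f x * fE (act q x a) := by
  have hx : x ∈ Subgroup.closure (Set.range g) := by rw [hg]; trivial
  induction hx using Subgroup.closure_induction generalizing a with
  | mem x hx =>
    obtain ⟨j, rfl⟩ := hx
    -- For fixed `j` both sides are homomorphisms on `G ∧^q G`, so agreement on the `w i` suffices.
    have : (MulAut.conj (f (g j))⁻¹).toMonoidHom.comp fE = fE.comp (act q (g j)) := by
      refine MonoidHom.eq_of_eqOn_dense hw ?_
      rintro _ ⟨i, rfl⟩
      simp [h, mul_assoc]
    have := DFunLike.congr_fun this a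
    simp only [MonoidHom.comp_apply] at this
    rw [← this]
    simp [mul_assoc]
  | one => simp
  | mul x y _ _ hx hy => rw [map_mul, ← mul_assoc, hx, mul_assoc, hy, act_mul, mul_assoc]
  | inv x _ hx =>
    have := hx (act q x⁻¹ a)
    rw [← act_mul, inv_mul_cancel, act_one] at this
    rw [map_inv, eq_inv_mul_iff_mul_eq, ← mul_assoc, ← this, mul_inv_cancel_right]

/-- The values of the commutators `[x, y^φ]` need only be checked on generators. -/
theorem rcomm_eq_hom_wedge (hg : Subgroup.closure (Set.range g) = ⊤) (fG fP : G →* K)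
    (hG : ∀ x a, fE a * fG x = fG x * fE (act q x a))
    (hP : ∀ x a, fE a * fP x = fP x * fE (act q x a))
    (h : ∀ i j, rcomm (fG (g i)) (fP (g j)) = fE (wedge q (g i) (g j))) (x y : G) :
    rcomm (fG x) (fP y) = fE (wedge q x y) := by
  have eG (x : G) (a : ExteriorSquare G q) : fE (act q x a) = rconj (fE a) (fG x) := by
    rw [rconj, mul_assoc, hG, inv_mul_cancel_left]
  have eP (x : G) (a : ExteriorSquare G q) : fE (act q x a) = rconj (fE a) (fP x) := by
    rw [rconj, mul_assoc, hP, inv_mul_cancel_left]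
  have hy : y ∈ Subgroup.closure (Set.range g) := by rw [hg]; trivial
  have hx : x ∈ Subgroup.closure (Set.range g) := by rw [hg]; trivial
  -- Both sides obey the same biderivation rules, the commutator by the usual identities. The outer
  -- induction reduces `y` to a generator; only then is `x` reduced in the same way.
  induction hy using Subgroup.closure_induction with
  | mem y hy =>
    obtain ⟨j, rfl⟩ := hy
    induction hx using Subgroup.closure_induction with
    | mem x hx => obtain ⟨i, rfl⟩ := hx; exact h i j
    | one => simp [rcomm, wedge_one_left]
    | mul x y _ _ hx hy =>
      rw [wedge_mul_left, map_mul fE, eG, ← hx, ← hy, map_mul]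
      simp only [rcomm, rconj]; group
    | inv x _ hx =>
      have := congrArg fE (wedge_mul_left q x⁻¹ x (g j))
      rw [inv_mul_cancel, wedge_one_left, map_one, map_mul, eG, ← hx, eq_comm,
        mul_eq_one_iff_eq_inv] at this
      have e (a b : K) (h : rconj a (fG x) = b) : a = fG x * b * (fG x)⁻¹ := by
        rw [← h, rconj]; group
      rw [e _ _ this, map_inv]
      simp only [rcomm]; group
  | one => simp [rcomm, wedge_one_right]
  | mul y z _ _ hy hz =>
    rw [wedge_mul_right, map_mul fE, eP, ← hy, ← hz, map_mul]
    simp only [rcomm, rconj]; group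
  | inv y _ hy =>
    have := congrArg fE (wedge_mul_right q x y⁻¹ y)
    rw [inv_mul_cancel, wedge_one_right, map_one, map_mul, eP, ← hy, eq_comm,
      mul_eq_one_iff_inv_eq] at this
    have e (a b : K) (h : b = rconj a (fP y)) : a = fP y * b * (fP y)⁻¹ := by
      rw [h, rconj]; group
    rw [e _ _ this, map_inv]
    simp only [rcomm]; group

end FromModel

/-- The group `τ^q(G)` is isomorphic to its model. -/
theorem exists_tau_equiv_model (hPG : P.Presents g) (hQA : Q.Presents w)
    (hc : ∀ a, collect w (c a) = a) :
    ∃ Φ : Tau q P Q g w c ≃* TauModel G q, (∀ i, Φ (tauG q P Q g w c i) = TauModel.inG q (g i)) ∧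
      (∀ i, Φ (tauP q P Q g w c i) = TauModel.inP q (g i)) ∧
      ∀ i, Φ (tauW q P Q g w c i) = TauModel.inE (w i) := by
  let π := PresentedGroup.mk (tauRels q P Q g w c)
  have hπ {x y : FreeGroup (TauGen n r)} (h : TauRel q P Q g w c (x * y⁻¹)) : π x = π y := by
    have h1 : π (x * y⁻¹) = 1 := PresentedGroup.one_of_mem (rels := tauRels q P Q g w c) h
    rw [map_mul, map_inv] at h1
    exact mul_inv_eq_one.1 h1
  have hL {X : Type} (s : X → TauGen n r) (x : FreeGroup X)
      (hx : TauRel q P Q g w c (FreeGroup.map s x)) :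
      FreeGroup.lift (fun i => (PresentedGroup.of (s i) : Tau q P Q g w c)) x = 1 := by
    have h1 : π (FreeGroup.map s x) = 1 :=
      PresentedGroup.one_of_mem (rels := tauRels q P Q g w c) hx
    rw [← h1, ← MonoidHom.comp_apply]
    congr 1
    ext i
    simp [π, PresentedGroup.of]
  obtain ⟨fG, hfG⟩ := hPG.exists_hom (tauG q P Q g w c) fun s hs => hL sG s (.relG s hs)
  obtain ⟨fP, hfP⟩ := hPG.exists_hom (tauP q P Q g w c) fun s hs => hL sP s (.relP s hs)
  obtain ⟨fE, hfE⟩ := hQA.exists_hom (tauW q P Q g w c) fun s hs => hL sW s (.relW s hs)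
  -- The choice of words does not matter: the relators `u_i` alone give `fE`, and any word
  -- representing `a` evaluates to `fE a`.
  have hW (a : ExteriorSquare G q) : π (wWord q c a) = fE a := by
    rw [wWord, map_collect, ← congrArg fE (hc a), map_collect]
    congr 1
    funext i
    exact (hfE i).symm
  have xG' (i : Fin n) : π (xG i) = fG (g i) := (hfG i).symm
  have xP' (i : Fin n) : π (xP i) = fP (g i) := (hfP i).symm
  have xW' (i : Fin r) : π (xW i) = fE (w i) := (hfE i).symm
  have hg := hPG.closure_range
  have hw := hQA.closure_range
  -- The relations for conjugation by the `g_j` themselves suffice; those for the inverses follow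
  -- from them in a group.
  have hG : ∀ x a, fE a * fG x = fG x * fE (act q x a) := by
    refine hom_mul_eq_mul_act q hg hw fG fun i j => ?_
    have h := hπ (.actG i j)
    rw [map_mul, map_mul, map_inv, hW, xG', xW', mul_assoc, inv_mul_eq_iff_eq_mul] at h
    exact h
  have hP : ∀ x a, fE a * fP x = fP x * fE (act q x a) := by
    refine hom_mul_eq_mul_act q hg hw fP fun i j => ?_
    have h := hπ (.actP i j)
    rw [map_mul, map_mul, map_inv, hW, xP', xW', mul_assoc, inv_mul_eq_iff_eq_mul] at h
    exact h
  have hC : ∀ x y, rcomm (fG x) (fP y) = fE (wedge q x y) := by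
    refine rcomm_eq_hom_wedge q hg fG fP hG hP fun i j => ?_
    have h := hπ (.mixed i j)
    rw [map_mul, map_mul, map_inv, map_mul, hW, xG', xP', lam_one_right, map_inv,
      eq_mul_inv_iff_mul_eq, ← eq_inv_mul_iff_mul_eq] at h
    rw [h, rcomm]; group
  let Φ : Tau q P Q g w c →* TauModel G q :=
    PresentedGroup.toGroup (lift_modelGen_eq_one q hPG hQA hc)
  let Ψ : TauModel G q →* Tau q P Q g w c := TauModel.lift fG fP fE hG hP hC
  have eG (i : Fin n) : Φ (tauG q P Q g w c i) = TauModel.inG q (g i) := by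
    simp [Φ, tauG, modelGen]
  have eP (i : Fin n) : Φ (tauP q P Q g w c i) = TauModel.inP q (g i) := by
    simp [Φ, tauP, modelGen]
  have eW (i : Fin r) : Φ (tauW q P Q g w c i) = TauModel.inE (w i) := by
    simp [Φ, tauW, modelGen]
  have h1 : Ψ.comp Φ = MonoidHom.id _ := by
    apply PresentedGroup.ext
    intro s
    induction s using tauGen_cases with
    | hG i =>
      change Ψ (Φ (tauG q P Q g w c i)) = tauG q P Q g w c i
      rw [eG, TauModel.lift_inG, hfG]
    | hP i =>
      change Ψ (Φ (tauP q P Q g w c i)) = tauP q P Q g w c i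
      rw [eP, TauModel.lift_inP, hfP]
    | hW i =>
      change Ψ (Φ (tauW q P Q g w c i)) = tauW q P Q g w c i
      rw [eW, TauModel.lift_inE, hfE]
  have h2 : Φ.comp Ψ = MonoidHom.id _ := by
    apply TauModel.hom_ext
    · refine DFunLike.congr_fun (f := (Φ.comp Ψ).comp (TauModel.inG q)) (g := TauModel.inG q)
        (MonoidHom.eq_of_eqOn_dense hg ?_)
      rintro _ ⟨i, rfl⟩
      change Φ (Ψ _) = _
      rw [TauModel.lift_inG, hfG, eG]
    · refine DFunLike.congr_fun (f := (Φ.comp Ψ).comp (TauModel.inP q)) (g := TauModel.inP q)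
        (MonoidHom.eq_of_eqOn_dense hg ?_)
      rintro _ ⟨i, rfl⟩
      change Φ (Ψ _) = _
      rw [TauModel.lift_inP, hfP, eP]
    · refine DFunLike.congr_fun (f := (Φ.comp Ψ).comp TauModel.inE) (g := TauModel.inE)
        (MonoidHom.eq_of_eqOn_dense hw ?_)
      rintro _ ⟨i, rfl⟩
      change Φ (Ψ _) = _
      rw [TauModel.lift_inE, hfE, eW]
  exact ⟨MonoidHom.toMulEquiv Φ Ψ h1 h2, eG, eP, eW⟩

end Tau

/-! ### The polycyclic form of the presentation of `τ^q(G)` and its consistency. -/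

section Consistency

variable {n r : ℕ}

theorem collect_tauGen {H : Type*} [Group H] (x : TauGen n r → H) (a : TauGen n r → ℤ) :
    collect x a = collect (fun i => x (sG i)) (fun i => a (sG i)) *
      (collect (fun i => x (sP i)) (fun i => a (sP i)) *
        collect (fun i => x (sW i)) (fun i => a (sW i))) := by
  rw [collect_lex, collect_lex]
  rfl

@[simp] theorem sG_lt_sG {i j : Fin n} : (sG i : TauGen n r) < sG j ↔ i < j :=
  Sum.Lex.inl_lt_inl_iff

@[simp] theorem sP_lt_sP {i j : Fin n} : (sP i : TauGen n r) < sP j ↔ i < j :=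
  Sum.Lex.inr_lt_inr_iff.trans Sum.Lex.inl_lt_inl_iff

@[simp] theorem sW_lt_sW {i j : Fin r} : (sW i : TauGen n r) < sW j ↔ i < j :=
  Sum.Lex.inr_lt_inr_iff.trans Sum.Lex.inr_lt_inr_iff

@[simp] theorem sG_lt_sP (i j : Fin n) : (sG i : TauGen n r) < sP j :=
  Sum.Lex.inl_lt_inr _ _

@[simp] theorem sG_lt_sW (i : Fin n) (j : Fin r) : sG i < sW j :=
  Sum.Lex.inl_lt_inr _ _

@[simp] theorem sP_lt_sW (i : Fin n) (j : Fin r) : sP i < sW j :=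
  Sum.Lex.inr_lt_inr_iff.2 (Sum.Lex.inl_lt_inr _ _)

@[simp] theorem not_sP_lt_sG (i j : Fin n) : ¬ (sP j : TauGen n r) < sG i :=
  (sG_lt_sP i j).not_gt

@[simp] theorem not_sW_lt_sG (i : Fin n) (j : Fin r) : ¬ sW j < sG i :=
  (sG_lt_sW i j).not_gt

@[simp] theorem not_sW_lt_sP (i : Fin n) (j : Fin r) : ¬ sW j < sP i :=
  (sP_lt_sW i j).not_gt

theorem collect_const_zero {X : Type*} [Fintype X] [LinearOrder X] {H : Type*} [Group H]
    (x : X → H) : (collect x fun _ => 0) = 1 :=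
  collect_zero x

section CollectAbove

variable {H : Type*} [Group H] (x : TauGen n r → H) (a b : Fin n → ℤ) (d : Fin r → ℤ)

theorem collectAbove_sG (i : Fin n) : collectAbove (sG i) x (tauElim a b d) =
    collectAbove i (fun k => x (sG k)) a *
      (collect (fun k => x (sP k)) b * collect (fun k => x (sW k)) d) := by
  simp [collectAbove_eq_collect, collect_tauGen]

theorem collectAbove_sP (i : Fin n) : collectAbove (sP i) x (tauElim a b d) =
    collectAbove i (fun k => x (sP k)) b * collect (fun k => x (sW k)) d := by
  simp [collectAbove_eq_collect, collect_tauGen, collect_const_zero]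

theorem collectAbove_sW (i : Fin r) : collectAbove (sW i) x (tauElim a b d) =
    collectAbove i (fun k => x (sW k)) d := by
  simp [collectAbove_eq_collect, collect_tauGen, collect_const_zero]

end CollectAbove

@[simp]
theorem collectAbove_zero {X : Type*} [Fintype X] [LinearOrder X] {H : Type*} [Group H] (i : X)
    (x : X → H) : collectAbove i x 0 = 1 := by
  simp [collectAbove_eq_collect, collect_const_zero]

variable {G : Type*} [Group G] (q : ℕ) (P : PcPresentation (Fin n)) (Q : PcPresentation (Fin r))
  (g : Fin n → G) (w : Fin r → ExteriorSquare G q) (c : ExteriorSquare G q → Fin r → ℤ)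

variable {c} in
theorem wWord_eq (a : ExteriorSquare G q) :
    (wWord q c a : FreeGroup (TauGen n r)) = collect (fun k => FreeGroup.of (sW k)) (c a) := rfl

/-- The polycyclic presentation of `τ^q(G)`. -/
def tauPc : PcPresentation (TauGen n r) where
  I := tauElim (· ∈ P.I) (· ∈ P.I) (· ∈ Q.I)
  e := tauElim P.e P.e Q.e
  e_pos s := by
    induction s using tauGen_cases with
    | hG i => exact P.e_pos i
    | hP i => exact P.e_pos i
    | hW i => exact Q.e_pos i
  -- Each exponent vector is split into blocks for the `g`, the `g^φ` and the `w`; each power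
  -- relation stays inside its own block.
  α := tauElim (fun i => tauElim (P.α i) 0 0) (fun i => tauElim 0 (P.α i) 0)
    (fun i => tauElim 0 0 (Q.α i))
  -- Pairs whose conjugating generator lies in a later block get the default `0`, which no relator
  -- reads.
  β := tauElim (fun i => tauElim (fun j => tauElim (P.β i j) 0 0) 0 0)
    (fun i => tauElim
      -- The right-hand side of a mixed relation is a single `g_i^φ` followed by a word in the `w`,
      -- hence the unit vector in the middle block.
      (fun j => tauElim 0 (Pi.single i 1) (c (lam q (g j) (g i) 1)⁻¹))
      (fun j => tauElim 0 (P.β i j) 0) 0)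
    (fun i => tauElim
      (fun j => tauElim 0 0 (c (act q (g j) (w i))))
      (fun j => tauElim 0 0 (c (act q (g j) (w i))))
      (fun j => tauElim 0 0 (Q.β i j)))
  γ := tauElim (fun i => tauElim (fun j => tauElim (P.γ i j) 0 0) 0 0)
    (fun i => tauElim
      (fun j => tauElim 0 (Pi.single i 1) (c (lam q (g j)⁻¹ (g i) 1)⁻¹))
      (fun j => tauElim 0 (P.γ i j) 0) 0)
    (fun i => tauElim
      (fun j => tauElim 0 0 (c (act q (g j)⁻¹ (w i))))
      (fun j => tauElim 0 0 (c (act q (g j)⁻¹ (w i))))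
      (fun j => tauElim 0 0 (Q.γ i j)))

/-- The relators must agree as elements of the free group, not just up to consequence. They do,
since the order `g < g^φ < w` makes every right-hand side a collected word in generators later than
the required one. -/
theorem tauPc_rel_of_tauRel {x : FreeGroup (TauGen n r)} (h : TauRel q P Q g w c x) :
    (tauPc q P Q g w c).Rel x := by
  cases h with
  | relG x hx =>
    cases hx with
    | power i hi =>
      convert PcPresentation.Rel.power (P := tauPc q P Q g w c) (sG i) hi using 1
      simp [tauPc, collectAbove_sG, map_collectAbove]
    | conj i j h =>
      convert PcPresentation.Rel.conj (P := tauPc q P Q g w c) (sG i) (sG j) (by simpa) using 1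
      simp [tauPc, collectAbove_sG, map_collectAbove]
    | conjInv i j h hj =>
      convert PcPresentation.Rel.conjInv (P := tauPc q P Q g w c) (sG i) (sG j) (by simpa) hj
        using 1
      simp [tauPc, collectAbove_sG, map_collectAbove]
  | relP x hx =>
    cases hx with
    | power i hi =>
      convert PcPresentation.Rel.power (P := tauPc q P Q g w c) (sP i) hi using 1
      simp [tauPc, collectAbove_sP, map_collectAbove]
    | conj i j h =>
      convert PcPresentation.Rel.conj (P := tauPc q P Q g w c) (sP i) (sP j) (by simpa) using 1
      simp [tauPc, collectAbove_sP, map_collectAbove]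
    | conjInv i j h hj =>
      convert PcPresentation.Rel.conjInv (P := tauPc q P Q g w c) (sP i) (sP j) (by simpa) hj
        using 1
      simp [tauPc, collectAbove_sP, map_collectAbove]
  | relW x hx =>
    cases hx with
    | power i hi =>
      convert PcPresentation.Rel.power (P := tauPc q P Q g w c) (sW i) hi using 1
      simp [tauPc, collectAbove_sW, map_collectAbove]
    | conj i j h =>
      convert PcPresentation.Rel.conj (P := tauPc q P Q g w c) (sW i) (sW j) (by simpa) using 1
      simp [tauPc, collectAbove_sW, map_collectAbove]
    | conjInv i j h hj =>
      convert PcPresentation.Rel.conjInv (P := tauPc q P Q g w c) (sW i) (sW j) (by simpa) hj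
        using 1
      simp [tauPc, collectAbove_sW, map_collectAbove]
  | mixed i j =>
    convert PcPresentation.Rel.conj (P := tauPc q P Q g w c) (sP j) (sG i) (by simp) using 1
    simp [tauPc, collectAbove_sG, collect_single, wWord_eq, xG, xP]
  | mixedInv i j hi =>
    convert PcPresentation.Rel.conjInv (P := tauPc q P Q g w c) (sP j) (sG i) (by simp) hi using 1
    simp [tauPc, collectAbove_sG, collect_single, wWord_eq, xG, xP]
  | actG i j =>
    convert PcPresentation.Rel.conj (P := tauPc q P Q g w c) (sW i) (sG j) (by simp) using 1
    simp [tauPc, collectAbove_sG, wWord_eq, xG, xW]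
  | actGInv i j hj =>
    convert PcPresentation.Rel.conjInv (P := tauPc q P Q g w c) (sW i) (sG j) (by simp) hj using 1
    simp [tauPc, collectAbove_sG, wWord_eq, xG, xW]
  | actP i j =>
    convert PcPresentation.Rel.conj (P := tauPc q P Q g w c) (sW i) (sP j) (by simp) using 1
    simp [tauPc, collectAbove_sP, wWord_eq, xP, xW]
  | actPInv i j hj =>
    convert PcPresentation.Rel.conjInv (P := tauPc q P Q g w c) (sW i) (sP j) (by simp) hj using 1
    simp [tauPc, collectAbove_sP, wWord_eq, xP, xW]

theorem tauRel_of_tauPc_rel {x : FreeGroup (TauGen n r)} (h : (tauPc q P Q g w c).Rel x) :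
    TauRel q P Q g w c x := by
  cases h with
  | power i hi =>
    induction i using tauGen_cases with
    | hG i =>
      convert TauRel.relG (q := q) (P := P) (Q := Q) (g := g) (w := w) (c := c) _ (.power i hi) using 1
      simp [tauPc, collectAbove_sG, map_collectAbove]
    | hP i =>
      convert TauRel.relP (q := q) (P := P) (Q := Q) (g := g) (w := w) (c := c) _ (.power i hi) using 1
      simp [tauPc, collectAbove_sP, map_collectAbove]
    | hW i =>
      convert TauRel.relW (q := q) (P := P) (Q := Q) (g := g) (w := w) (c := c) _ (.power i hi) using 1
      simp [tauPc, collectAbove_sW, map_collectAbove]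
  | conj i j h =>
    induction i using tauGen_cases with
    | hG i =>
      induction j using tauGen_cases with
      | hG j =>
        convert TauRel.relG (q := q) (P := P) (Q := Q) (g := g) (w := w) (c := c) _
          (.conj i j (by simpa using h)) using 1
        simp [tauPc, collectAbove_sG, map_collectAbove]
      | hP j => simp at h
      | hW j => simp at h
    | hP i =>
      induction j using tauGen_cases with
      | hG j =>
        convert TauRel.mixed (q := q) (P := P) (Q := Q) (g := g) (w := w) (c := c) j i using 1
        simp [tauPc, collectAbove_sG, collect_single, wWord_eq, xG, xP]
      | hP j =>
        convert TauRel.relP (q := q) (P := P) (Q := Q) (g := g) (w := w) (c := c) _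
          (.conj i j (by simpa using h)) using 1
        simp [tauPc, collectAbove_sP, map_collectAbove]
      | hW j => simp at h
    | hW i =>
      induction j using tauGen_cases with
      | hG j =>
        convert TauRel.actG (q := q) (P := P) (Q := Q) (g := g) (w := w) (c := c) i j using 1
        simp [tauPc, collectAbove_sG, wWord_eq, xG, xW]
      | hP j =>
        convert TauRel.actP (q := q) (P := P) (Q := Q) (g := g) (w := w) (c := c) i j using 1
        simp [tauPc, collectAbove_sP, wWord_eq, xP, xW]
      | hW j =>
        convert TauRel.relW (q := q) (P := P) (Q := Q) (g := g) (w := w) (c := c) _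
          (.conj i j (by simpa using h)) using 1
        simp [tauPc, collectAbove_sW, map_collectAbove]
  | conjInv i j h hj =>
    induction i using tauGen_cases with
    | hG i =>
      induction j using tauGen_cases with
      | hG j =>
        convert TauRel.relG (q := q) (P := P) (Q := Q) (g := g) (w := w) (c := c) _
          (.conjInv i j (by simpa using h) hj) using 1
        simp [tauPc, collectAbove_sG, map_collectAbove]
      | hP j => simp at h
      | hW j => simp at h
    | hP i =>
      induction j using tauGen_cases with
      | hG j =>
        convert TauRel.mixedInv (q := q) (P := P) (Q := Q) (g := g) (w := w) (c := c) j i hj using 1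
        simp [tauPc, collectAbove_sG, collect_single, wWord_eq, xG, xP]
      | hP j =>
        convert TauRel.relP (q := q) (P := P) (Q := Q) (g := g) (w := w) (c := c) _
          (.conjInv i j (by simpa using h) hj) using 1
        simp [tauPc, collectAbove_sP, map_collectAbove]
      | hW j => simp at h
    | hW i =>
      induction j using tauGen_cases with
      | hG j =>
        convert TauRel.actGInv (q := q) (P := P) (Q := Q) (g := g) (w := w) (c := c) i j hj using 1
        simp [tauPc, collectAbove_sG, wWord_eq, xG, xW]
      | hP j =>
        convert TauRel.actPInv (q := q) (P := P) (Q := Q) (g := g) (w := w) (c := c) i j hj using 1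
        simp [tauPc, collectAbove_sP, wWord_eq, xP, xW]
      | hW j =>
        convert TauRel.relW (q := q) (P := P) (Q := Q) (g := g) (w := w) (c := c) _
          (.conjInv i j (by simpa using h) hj) using 1
        simp [tauPc, collectAbove_sW, map_collectAbove]

theorem tauPc_rels : (tauPc q P Q g w c).rels = tauRels q P Q g w c :=
  Set.ext fun _ => ⟨tauRel_of_tauPc_rel q P Q g w c, tauPc_rel_of_tauRel q P Q g w c⟩

theorem tauPc_isReduced_iff (a : TauGen n r → ℤ) : (tauPc q P Q g w c).IsReduced a ↔
    P.IsReduced (fun i => a (sG i)) ∧ P.IsReduced (fun i => a (sP i)) ∧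
      Q.IsReduced (fun i => a (sW i)) := by
  refine ⟨fun h => ⟨fun i hi => h (sG i) hi, fun i hi => h (sP i) hi, fun i hi => h (sW i) hi⟩,
    fun ⟨h1, h2, h3⟩ s => ?_⟩
  induction s using tauGen_cases with
  | hG i => exact h1 i
  | hP i => exact h2 i
  | hW i => exact h3 i

/-- The reason for consistency: the coordinates of the model are the three collected blocks, so
existence and uniqueness of reduced forms are inherited from `G`, `G` and `G ∧^q G`. -/
theorem collect_modelGen (a : TauGen n r → ℤ) : collect (modelGen q g w) a =
    ⟨collect g fun i => a (sG i), collect g fun i => a (sP i), collect w fun i => a (sW i)⟩ := by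
  rw [collect_tauGen, ← TauModel.inG_mul_inP_mul_inE, map_collect, map_collect, map_collect,
    mul_assoc]
  rfl

variable {P Q g w c}

theorem tau_isConsistent (hP : P.Consistent) (hPG : P.Presents g) (hQ : Q.Consistent)
    (hQA : Q.Presents w) (hc : ∀ a, collect w (c a) = a) :
    IsConsistentPcPresentation (tauRels q P Q g w c) := by
  refine ⟨tauPc q P Q g w c, tauPc_rels q P Q g w c, ?_⟩
  obtain ⟨Φ, hΦG, hΦP, hΦW⟩ := exists_tau_equiv_model q hPG hQA hc
  have h : (tauPc q P Q g w c).Presents (modelGen q g w) := by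
    convert (PcPresentation.presents_of_rels_eq (tauPc_rels q P Q g w c)).comp Φ using 1
    funext s
    induction s using tauGen_cases with
    | hG i => exact (hΦG i).symm
    | hP i => exact (hΦP i).symm
    | hW i => exact (hΦW i).symm
  rw [h.consistent_iff]
  rintro ⟨x, y, a⟩
  rw [hPG.consistent_iff] at hP
  rw [hQA.consistent_iff] at hQ
  obtain ⟨a₁, ⟨h₁, h₁'⟩, u₁⟩ := hP x
  obtain ⟨a₂, ⟨h₂, h₂'⟩, u₂⟩ := hP y
  obtain ⟨a₃, ⟨h₃, h₃'⟩, u₃⟩ := hQ a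
  refine ⟨tauElim a₁ a₂ a₃, ⟨(tauPc_isReduced_iff q P Q g w c _).2 ⟨h₁, h₂, h₃⟩, ?_⟩, ?_⟩
  · rw [collect_modelGen]
    simp [h₁', h₂', h₃']
  · rintro b ⟨hb, hb'⟩
    obtain ⟨k₁, k₂, k₃⟩ := (tauPc_isReduced_iff q P Q g w c _).1 hb
    rw [collect_modelGen, TauModel.mk.injEq] at hb'
    funext s
    induction s using tauGen_cases with
    | hG i => exact congrFun (u₁ _ ⟨k₁, hb'.1⟩) i
    | hP i => exact congrFun (u₂ _ ⟨k₂, hb'.2.1⟩) i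
    | hW i => exact congrFun (u₃ _ ⟨k₃, hb'.2.2⟩) i

end Consistency

end QTau

/-! ### The theorem, transported from the model. -/

open QTau

theorem mainTheorem2 {G : Type*} [Group G] (q n r : ℕ)
    (P : PcPresentation (Fin n)) (g : Fin n → G)
    (hP : P.Consistent) (hPG : P.Presents g)
    (Q : PcPresentation (Fin r)) (w : Fin r → ExteriorSquare G q)
    (hQ : Q.Consistent) (hQA : Q.Presents w)
    (c : ExteriorSquare G q → Fin r → ℤ) (hc : ∀ a, collect w (c a) = a) :
    (∃ _ : (subW q P Q g w c).Normal,
      ∃ f : Tau q P Q g w c ⧸ subW q P Q g w c ≃* G × G,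
        ∀ i, f (tauG q P Q g w c i) = (g i, 1) ∧ f (tauP q P Q g w c i) = (1, g i)) ∧
    IsConsistentPcPresentation (tauRels q P Q g w c) ∧
    ∃ θ : ExteriorSquare G q ≃* subW q P Q g w c,
      (∀ i, (θ (w i) : Tau q P Q g w c) = tauW q P Q g w c i) ∧
      ∃ ψ : Nu G q →* Tau q P Q g w c,
        (∀ i, ψ (nuL q (g i)) = tauG q P Q g w c i) ∧
        (∀ i, ψ (nuR q (g i)) = tauP q P Q g w c i) ∧
        (∀ (hq : q ≠ 0) (k : G), ψ (nuHat hq k) = θ (lam q 1 1 k)) ∧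
        ψ.ker = Delta G q := by
  obtain ⟨Φ, hΦG, hΦP, hΦW⟩ := exists_tau_equiv_model q hPG hQA hc
  let φ : Tau q P Q g w c →* G × G := (TauModel.toProd G q).comp Φ.toMonoidHom
  let ι : ExteriorSquare G q →* Tau q P Q g w c := Φ.symm.toMonoidHom.comp TauModel.inE
  have hιw (i : Fin r) : ι (w i) = tauW q P Q g w c i := by
    change Φ.symm (TauModel.inE (w i)) = _
    rw [← hΦW, Φ.symm_apply_apply]
  have hι : ι.range = subW q P Q g w c := by
    rw [MonoidHom.range_eq_map, ← hQA.closure_range, MonoidHom.map_closure, subW, ← Set.range_comp]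
    exact congrArg (fun f => Subgroup.closure (Set.range f)) (funext hιw)
  -- Triples `(1, 1, a)` are both the kernel of the projection to `G × G` and the copy of `G ∧^q G`,
  -- which the `w_i` generate. This settles normality of `W`, the quotient, and `θ` together.
  have hφ : φ.ker = subW q P Q g w c := by
    rw [← hι]
    ext x
    refine ⟨fun hx => ⟨(Φ x).base, ?_⟩, ?_⟩
    · change Φ.symm (TauModel.inE (Φ x).base) = x
      rw [← TauModel.toProd_eq_one (m := Φ x) hx, Φ.symm_apply_apply]
    · rintro ⟨a, rfl⟩
      change TauModel.toProd G q (Φ (Φ.symm (TauModel.inE a))) = 1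
      rw [Φ.apply_symm_apply]
      rfl
  have hφs : Function.Surjective φ := fun ⟨x, y⟩ =>
    ⟨Φ.symm ⟨x, y, 1⟩, congrArg (TauModel.toProd G q) (Φ.apply_symm_apply _)⟩
  have hN : (subW q P Q g w c).Normal := hφ ▸ inferInstance
  have hιi : Function.Injective ι := Φ.symm.injective.comp TauModel.inE_injective
  refine ⟨⟨hN, (QuotientGroup.quotientMulEquivOfEq hφ.symm).trans
    (QuotientGroup.quotientKerEquivOfSurjective φ hφs), fun i => ⟨?_, ?_⟩⟩,
    tau_isConsistent q hP hPG hQ hQA hc,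
    (MonoidHom.ofInjective hιi).trans (MulEquiv.subgroupCongr hι), hιw,
    Φ.symm.toMonoidHom.comp (nuToModel q), fun i => ?_, fun i => ?_, fun hq k => ?_, ?_⟩
  · change TauModel.toProd G q (Φ (tauG q P Q g w c i)) = _
    rw [hΦG]
    rfl
  · change TauModel.toProd G q (Φ (tauP q P Q g w c i)) = _
    rw [hΦP]
    rfl
  · change Φ.symm (nuToModel q (nuL q (g i))) = _
    rw [nuToModel_nuL, ← hΦG, Φ.symm_apply_apply]
  · change Φ.symm (nuToModel q (nuR q (g i))) = _
    rw [nuToModel_nuR, ← hΦP, Φ.symm_apply_apply]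
  · change Φ.symm (nuToModel q (nuHat hq k)) = ι (lam q 1 1 k)
    rw [nuToModel_nuHat, lam_one_left]
    rfl
  -- Following `nuToModel` by an isomorphism does not change its kernel.
  · rw [← nuToModel_ker]
    exact MonoidHom.ker_mulEquiv_comp _ Φ.symm
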